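/- Let $n\ge 2$. A convex body in $\mathbb{R}^n$ is a compact convex set with non-empty interior; it is smooth if it has a unique supporting hyperplane at each boundary point, and centrally symmetric if it has a center of symmetry. For convex bodies $K,L\subset\mathbb{R}^n$ put $$d(K,L)=\inf\{r>0:\ K+u\subset T(L+v)\subset r(K+u)\},\qquad d_G(K,L)=\inf\{|r|:\ r\in\mathbb{R},\ K+u\subset T(L+v)\subset r(K+u)\},$$ the infima being also over all invertible linear $T:\mathbb{R}^n\to\mathbb{R}^n$ and $u,v\in\mathbb{R}^n$ (the Banach–Mazur and the Grünbaum distance). For a convex body $M$ with $0\in\operatorname{int}M$ let $\|x\|_M=\inf\{t>0: x\in tM\}$, let $M^\circ=\{x:\langle x,y\rangle\le 1\text{ for all }y\in M\}$ be its polar body, and for $t\in[0,1]$ let $$\delta_M(t)=\inf\left\{1-\left\|\tfrac{x+y}{2}\right\|_M:\ x,y\in M,\ \|x-y\|_M\ge t\right\}$$ be its modulus of convexity. Let $S_n$ be a regular simplex in $\mathbb{R}^n$. **Theorem.** Let $L\subset\mathbb{R}^n$ be a smooth convex body with $0\in\operatorname{int}L$ and $L\subset -nL$. There is $\varepsilon_0(L)>0$,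 depending only on $L$, such that for every convex body $K\subset\mathbb{R}^n$ and every $0\le\varepsilon\le\varepsilon_0(L)$ with $d_G(K,L)\ge(1-\varepsilon)n$, $$d(K,S_n)\le 1+40n^3r,$$ where $r$ and $\varepsilon_0(L)$ can be taken as follows (in each case $\varepsilon_0(L)>0$ and, for every $0\le\varepsilon\le\varepsilon_0(L)$, an admissible $r\in[0,1)$ exists). 1. For every such $L$: $\varepsilon_0(L)=\dfrac{\delta_{L^\circ}\left(\frac{1}{80n^6}\right)}{80n^5}$, and $r$ is any number with $0\le r<1$ and $r\cdot\delta_{L^\circ}\left(\frac{r}{4n^3}\right)\ge 4n^2\varepsilon$. 2. If $L$ is moreover centrally symmetric: $\varepsilon_0(L)=\dfrac{\delta_{L^\circ}\left(\frac{1}{40n^5}\right)}{80n^4}$, and $r$ is any number with $0\le r<1$ and $r\cdot\delta_{L^\circ}\left(\frac{r}{2n^2}\right)\ge 4n\varepsilon$. 3. If $L$ is an ellipsoid: $\varepsilon_0(L)=\dfrac{1}{128000n^9}$ and $r=(16\varepsilon)^{1/3}$. -/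

import Mathlib

open scoped Pointwise RealInnerProductSpace

namespace Grunbaum

variable {E : Type*} [NormedAddCommGroup E] [InnerProductSpace ℝ E]

/-- A convex body: a compact convex set with non-empty interior. -/
structure IsBody (K : Set E) : Prop where
  convex : Convex ℝ K
  compact : IsCompact K
  interior_nonempty : (interior K).Nonempty

/-- The (one-sided) polar body `{x : ⟪x, y⟫ ≤ 1 for every y ∈ K}`. -/
def polarBody (K : Set E) : Set E := {x | ∀ y ∈ K, ⟪x, y⟫ ≤ 1}

/-- The hyperplane `H` passes through the point `x` and supports `K` there. -/
def IsSupportingHyperplane (K : Set E) (x : E) (H : Set E) : Prop :=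
  ∃ f : E, f ≠ 0 ∧ (∀ y ∈ K, ⟪y, f⟫ ≤ ⟪x, f⟫) ∧ H = {y : E | ⟪y, f⟫ = ⟪x, f⟫}

/-- A body is smooth if it has a unique supporting hyperplane at each boundary point. -/
def IsSmoothBody (K : Set E) : Prop :=
  ∀ x ∈ frontier K, ∃! H : Set E, IsSupportingHyperplane K x H

/-- `K` has a center of symmetry (not necessarily the origin). -/
def IsCentrallySymmetric (K : Set E) : Prop :=
  ∃ c : E, ∀ x ∈ K, (2 : ℝ) • c - x ∈ K

/-- An ellipsoid: a non-degenerate affine image of the Euclidean unit ball. -/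
def IsEllipsoid (K : Set E) : Prop :=
  ∃ (T : E ≃ₗ[ℝ] E) (c : E), K = c +ᵥ (T '' Metric.closedBall (0 : E) 1)

/-- The modulus of convexity of `K`,
`δ_K(t) = inf {1 - ‖(x + y) / 2‖_K : x, y ∈ K, ‖x - y‖_K ≥ t}`,
where `‖·‖_K` is the gauge function of `K`. It is used for `0 ∈ int K` and `0 ≤ t ≤ 1`. -/
noncomputable def modulusOfConvexity (K : Set E) (t : ℝ) : ℝ :=
  sInf {a : ℝ | ∃ x ∈ K, ∃ y ∈ K, t ≤ gauge K (x - y) ∧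
    a = 1 - gauge K ((1 / 2 : ℝ) • (x + y))}

/-- Some translate of `K` and some affine image of `L` satisfy
`K + u ⊆ T(L + v) ⊆ r(K + u)`, with `T` linear and invertible. -/
def Sandwich (K L : Set E) (r : ℝ) : Prop :=
  ∃ (T : E ≃ₗ[ℝ] E) (u v : E), u +ᵥ K ⊆ T '' (v +ᵥ L) ∧ T '' (v +ᵥ L) ⊆ r • (u +ᵥ K)

/-- The Banach-Mazur distance of convex bodies: only positive ratios are allowed. -/
noncomputable def distBM (K L : Set E) : ℝ := sInf {r : ℝ | 0 < r ∧ Sandwich K L r}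

/-- The Grünbaum distance of convex bodies: ratios of either sign are allowed. -/
noncomputable def distG (K L : Set E) : ℝ := sInf {a : ℝ | ∃ r : ℝ, a = |r| ∧ Sandwich K L r}

/-- A regular simplex: the convex hull of `n + 1` affinely independent points
whose mutual distances are all equal. -/
def IsRegularSimplex (n : ℕ) (S : Set E) : Prop :=
  ∃ s : Affine.Simplex ℝ E n, s.Equilateral ∧ S = convexHull ℝ (Set.range s.points)

end Grunbaum

/-!
Stability of the simplex as the body at maximal Grünbaum distance from a smooth body `L`.

Replace `K` by the affine image for which `L ⊆ K` has maximal volume among the affine images of `L`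
inside `K` (`exists_maximal_volume_position`). John's theorem for pairs of bodies
(`exists_johnDecomposition`) gives contact points `x i ∈ L`, contact normals `f i ∈ K°` and weights
`c i` of sum `n` with `∑ c i (x i ⊗ f i) = id` and `∑ c i f i = 0`. On the other side,
`d_G(K, L) ≥ (1 - ε) n` and `ε < ε'` mean that no translate of `-(1 - ε') n L` contains `K`
(`distG_le_of_subset`); by Helly's theorem and separation (`exists_certificate`) this is witnessed
by `n + 1` points `p j ∈ K`, functionals `g j ∈ L°` and weights `w j` of sum `1` with
`∑ w j g j = 0` and `∑ w j ⟪-p j, g j⟫ > (1 - ε') n`. Writing `-p j` through the John decomposition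
gives
`∑ w j c i (1 - ⟪p j, f i⟫) (1 - ⟪x i, g j⟫) < ε' n`,
a sum of nonnegative terms (`JohnDecomposition.sum_sum_mul_one_sub`). Hence each `g j` of substantial
weight has some `⟪x i, g j⟫` close to `1 = ⟪x i, f i⟫`, and the modulus of convexity of `L°` forces
`g j` to be close to `f i`; as `f i ≤ 1` on `K`, also `g j ≤ 1 + τ` on `K` with `τ` small.

The functions `β k = w k (1 - ⟪·, g k⟫)` sum to `1` and are now nearly nonnegative on `K`, while
the trace of the matrix `β k (p j)` is at least `n + 1 - ε' n`. Each of its `n + 1` rows has sum `1`,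
so the matrix is close to the identity (`diag_ge_of_trace_ge`); the same count rules out small
weights `w k`. Therefore the `p j` are the vertices of a simplex inside `K`, and the barycentric
coordinates of the points of `K` with respect to it are nearly nonnegative
(`affineIndependent_and_coeff_ge`), that is, `K` lies in a slightly larger homothetic simplex
(`sandwich_simplex_of_coeff_ge`).

Smoothness of `L` is what makes the modulus of convexity of `L°` positive
(`modulusOfConvexity_pos`). The estimates leave enough room for the centrally symmetric case to
follow from the general argument. For ellipsoids one passes to the Euclidean ball, which satisfies
`-L = L` and not only `-L ⊆ n L`; there the contact normals are the contact points themselves, and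
`‖g - f‖² ≤ 2 (1 - ⟪f, g⟫)` replaces the modulus of convexity.
-/

namespace Grunbaum

open Set Filter Topology

variable {E : Type*} [NormedAddCommGroup E] [InnerProductSpace ℝ E]

/-! ### Polar bodies -/

theorem isClosed_polarBody (K : Set E) : IsClosed (polarBody K) := by
  have : polarBody K = ⋂ y ∈ K, {x | ⟪x, y⟫ ≤ 1} := by
    ext x; simp [polarBody]
  rw [this]
  exact isClosed_biInter fun y _ => isClosed_le (by fun_prop) continuous_const

theorem convex_polarBody (K : Set E) : Convex ℝ (polarBody K) := by
  intro x hx y hy a b ha hb hab z hz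
  have h1 := hx z hz
  have h2 := hy z hz
  rw [inner_add_left, real_inner_smul_left, real_inner_smul_left]
  nlinarith

theorem zero_mem_polarBody (K : Set E) : (0 : E) ∈ polarBody K := fun y _ => by simp

theorem polarBody_anti {K L : Set E} (h : L ⊆ K) : polarBody K ⊆ polarBody L :=
  fun _ hx y hy => hx y (h hy)

theorem isBounded_polarBody {K : Set E} (h0 : (0 : E) ∈ interior K) :
    Bornology.IsBounded (polarBody K) := by
  obtain ⟨ρ, hρ, hball⟩ := Metric.isOpen_iff.1 isOpen_interior 0 h0
  refine (Metric.isBounded_closedBall (x := (0 : E)) (r := 2 / ρ)).subset fun x hx => ?_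
  rw [mem_closedBall_zero_iff]
  by_cases hx0 : x = 0
  · subst hx0; simp; positivity
  have hnx : 0 < ‖x‖ := norm_pos_iff.2 hx0
  have hmem : (ρ / 2 / ‖x‖) • x ∈ K := by
    apply interior_subset; apply hball
    rw [mem_ball_zero_iff, norm_smul, Real.norm_of_nonneg (by positivity),
      div_mul_cancel₀ _ hnx.ne']
    linarith
  have := hx _ hmem
  rw [real_inner_smul_right, real_inner_self_eq_norm_sq] at this
  rw [le_div_iff₀ hρ]
  have h2 : ρ / 2 / ‖x‖ * ‖x‖ ^ 2 = ρ / 2 * ‖x‖ := by field_simp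
  linarith

theorem polarBody_mem_nhds {K : Set E} (hK : Bornology.IsBounded K) : polarBody K ∈ 𝓝 (0 : E) := by
  obtain ⟨M, hM, hKM⟩ := hK.exists_pos_norm_le
  refine mem_of_superset (Metric.ball_mem_nhds 0 (inv_pos.2 hM)) fun x hx y hy => ?_
  rw [mem_ball_zero_iff] at hx
  calc ⟪x, y⟫ ≤ ‖x‖ * ‖y‖ := real_inner_le_norm _ _
    _ ≤ M⁻¹ * M := by gcongr; exact hKM y hy
    _ = 1 := inv_mul_cancel₀ hM.ne'

section

variable [FiniteDimensional ℝ E]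

theorem isCompact_polarBody {K : Set E} (h0 : (0 : E) ∈ interior K) :
    IsCompact (polarBody K) :=
  Metric.isCompact_of_isClosed_isBounded (isClosed_polarBody K) (isBounded_polarBody h0)

/-- The bipolar theorem: a closed convex set containing the origin is cut out by the elements of
its polar body. -/
theorem mem_of_forall_polarBody {K : Set E} (hc : Convex ℝ K) (hcl : IsClosed K)
    (h0 : (0 : E) ∈ K) {x : E} (hx : ∀ f ∈ polarBody K, ⟪x, f⟫ ≤ 1) : x ∈ K := by
  by_contra hxK
  obtain ⟨φ, u, hu, hux⟩ := geometric_hahn_banach_closed_point hc hcl hxK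
  have hu0 : 0 < u := by simpa using hu 0 h0
  set v := (InnerProductSpace.toDual ℝ E).symm φ
  have hv : ∀ y, φ y = ⟪v, y⟫ := fun y => (InnerProductSpace.toDual_symm_apply).symm
  have h1 := hx (u⁻¹ • v) (fun y hy => by
    rw [real_inner_smul_left, ← hv, inv_mul_le_iff₀ hu0]; linarith [hu y hy])
  rw [real_inner_smul_right, real_inner_comm, ← hv, inv_mul_le_iff₀ hu0] at h1
  linarith

/-! ### Compactness of convex hulls -/

theorem sum_extend_zero {ι κ W : Type*} [Fintype ι] [Fintype κ] [AddCommMonoid W] (e : ι ↪ κ)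
    (G : ι → W) : ∑ i, Function.extend e G 0 i = ∑ j, G j := by
  symm
  refine Finset.sum_of_injOn e e.injective.injOn (by simp) ?_ ?_
  · intro i _ hi
    rw [Function.extend_apply']
    · rfl
    · rintro ⟨a, rfl⟩; exact hi (by simp)
  · intro i _; rw [e.injective.extend_apply]

/-- By Carathéodory's theorem the convex hull of `s` is the image of
`stdSimplex × s ^ (d + 1)`, with `d` the dimension, under the map taking convex combinations. -/
theorem isCompact_convexHull_of_isCompact {V : Type*} [NormedAddCommGroup V] [NormedSpace ℝ V]
    [FiniteDimensional ℝ V] {s : Set V} (hs : IsCompact s) : IsCompact (convexHull ℝ s) := by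
  rcases s.eq_empty_or_nonempty with rfl | ⟨z0, hz0⟩
  · simp
  set d := Module.finrank ℝ V
  let F : (Fin (d + 1) → ℝ) × (Fin (d + 1) → V) → V := fun p => ∑ i, p.1 i • p.2 i
  have hF : Continuous F := by fun_prop
  have hcomp : IsCompact (stdSimplex ℝ (Fin (d + 1)) ×ˢ
      (Set.pi univ fun _ : Fin (d + 1) => s)) :=
    (isCompact_stdSimplex ℝ _).prod (isCompact_univ_pi fun _ => hs)
  convert hcomp.image hF using 1
  apply Subset.antisymm
  · intro x hx
    obtain ⟨ι, hι, z, w, hz, haff, hw, hw1, hx⟩ := eq_pos_convex_span_of_mem_convexHull hx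
    have hcard : Fintype.card ι ≤ d + 1 := by
      refine (haff.card_le_finrank_succ).trans ?_
      exact Nat.succ_le_succ (Submodule.finrank_le _)
    obtain ⟨e⟩ : Nonempty (ι ↪ Fin (d + 1)) :=
      Function.Embedding.nonempty_of_card_le (by simpa using hcard)
    refine ⟨(Function.extend e w 0, Function.extend e z (fun _ => z0)), ⟨⟨?_, ?_⟩, ?_⟩, ?_⟩
    · intro i
      by_cases h : ∃ a, e a = i
      · obtain ⟨a, rfl⟩ := h
        simp only [e.injective.extend_apply]; exact (hw a).le
      · simp only [Function.extend_apply' _ _ _ h]; exact le_rfl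
    · exact (sum_extend_zero e w).trans hw1
    · intro i _
      by_cases h : ∃ a, e a = i
      · obtain ⟨a, rfl⟩ := h
        simp only [e.injective.extend_apply]; exact hz (mem_range_self a)
      · simp only [Function.extend_apply' _ _ _ h]; exact hz0
    · rw [← hx, ← sum_extend_zero e]
      refine Finset.sum_congr rfl fun i _ => ?_
      by_cases h : ∃ a, e a = i
      · obtain ⟨a, rfl⟩ := h
        simp only [e.injective.extend_apply]
      · simp [Function.extend_apply' _ _ _ h]
  · rintro _ ⟨⟨w, z⟩, ⟨⟨hw, hw1⟩, hz⟩, rfl⟩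
    exact mem_convexHull_of_exists_fintype w z hw hw1 (fun i => hz i (mem_univ i)) rfl

/-! ### Positions of maximal volume and the John decomposition -/

theorem eventually_one_lt_det_one_add_smul (B : E →ₗ[ℝ] E) (hB : 0 < LinearMap.trace ℝ E B) :
    ∀ᶠ s in 𝓝[>] (0 : ℝ), 1 < LinearMap.det (1 + s • B) := by
  classical
  let b := Module.finBasis ℝ E
  let M := LinearMap.toMatrix b b B
  have htr : LinearMap.trace ℝ E B = M.trace := LinearMap.trace_eq_matrix_trace ℝ b B
  set q := (Matrix.det (1 + (Polynomial.X : Polynomial ℝ) • M.map Polynomial.C)).divX.divX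
  have hdet : ∀ s : ℝ, LinearMap.det (1 + s • B) = 1 + M.trace * s + q.eval s * s ^ 2 := by
    intro s
    rw [← Matrix.det_one_add_smul, ← LinearMap.det_toMatrix b]
    congr 1
    simp only [map_add, map_smul]
    congr 1
    exact LinearMap.toMatrix_one b
  have hlim : Tendsto (fun s : ℝ => M.trace + q.eval s * s) (𝓝[>] 0) (𝓝 M.trace) := by
    have : Continuous fun s : ℝ => M.trace + q.eval s * s := by fun_prop
    have h := this.tendsto 0
    simp only [mul_zero, add_zero] at h
    exact h.mono_left nhdsWithin_le_nhds
  have hpos := hlim.eventually (lt_mem_nhds (htr ▸ hB))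
  filter_upwards [hpos, self_mem_nhdsWithin] with s hs hs0
  rw [hdet]
  have : 0 < (M.trace + q.eval s * s) * s := mul_pos hs hs0
  nlinarith

/-- Among the affine images of `L` inside `K` there is one of maximal volume; after an affine change
of coordinates for `K` it is `L` itself, so that every affine image of `L` inside `K` has at most
the volume of `L`. -/
theorem exists_maximal_volume_position {K L : Set E} (hK : IsBody K) (hL : IsBody L)
    (h0 : (0 : E) ∈ interior L) :
    ∃ (T : E ≃ₗ[ℝ] E) (a : E), L ⊆ a +ᵥ (T '' K) ∧
      ∀ (B : E →ₗ[ℝ] E) (b : E), (∀ x ∈ L, B x + b ∈ a +ᵥ (T '' K)) → LinearMap.det B ≤ 1 := by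
  have h0L : (0 : E) ∈ L := interior_subset h0
  let A : Set ((E →L[ℝ] E) × E) := {p | ∀ x ∈ L, p.1 x + p.2 ∈ K}
  have hcl : IsClosed A := by
    have : A = ⋂ x ∈ L, (fun p : (E →L[ℝ] E) × E => p.1 x + p.2) ⁻¹' K := by
      ext p; simp [A]
    rw [this]
    exact isClosed_biInter fun x _ => hK.compact.isClosed.preimage (by fun_prop)
  obtain ⟨M, hM, hKM⟩ := hK.compact.isBounded.exists_pos_norm_le
  obtain ⟨ρ, hρ, hball⟩ := Metric.isOpen_iff.1 isOpen_interior 0 h0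
  have hbd : Bornology.IsBounded A := by
    have hsub : A ⊆ Metric.closedBall (0 : E →L[ℝ] E) (2 * M / (ρ / 2)) ×ˢ
        Metric.closedBall (0 : E) M := by
      rintro ⟨B, b⟩ hp
      have hb : ‖b‖ ≤ M := by simpa using hKM _ (hp 0 h0L)
      refine ⟨?_, by simpa using hb⟩
      rw [mem_closedBall_zero_iff]
      refine ContinuousLinearMap.opNorm_le_of_unit_norm (by positivity) fun x hx => ?_
      have hxL : (ρ / 2) • x ∈ L := by
        apply interior_subset; apply hball
        rw [mem_ball_zero_iff, norm_smul, hx, Real.norm_of_nonneg (by positivity)]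
        linarith
      have h1 := hKM _ (hp _ hxL)
      have h2 : ‖B ((ρ / 2) • x)‖ ≤ 2 * M := by
        have := norm_sub_le (B ((ρ / 2) • x) + b) b
        rw [add_sub_cancel_right] at this
        simp only at h1
        linarith
      rw [map_smul, norm_smul, Real.norm_of_nonneg (by positivity)] at h2
      rw [le_div_iff₀ (by positivity)]
      linarith
    exact (Metric.isBounded_closedBall.prod Metric.isBounded_closedBall).subset hsub
  have hcomp : IsCompact A := Metric.isCompact_of_isClosed_isBounded hcl hbd
  -- a small homothetic copy of `L` fits into `K`, so the maximum of `|det|` is positive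
  obtain ⟨z, hz⟩ := hK.interior_nonempty
  obtain ⟨σ, hσ, hballK⟩ := Metric.isOpen_iff.1 isOpen_interior z hz
  obtain ⟨N, hN, hLN⟩ := hL.compact.isBounded.exists_pos_norm_le
  let A1 : (E →L[ℝ] E) := (σ / (2 * N)) • ContinuousLinearMap.id ℝ E
  have hA1 : (A1, z) ∈ A := by
    intro x hx
    apply interior_subset; apply hballK
    simp only [A1, smul_apply, ContinuousLinearMap.id_apply, Metric.mem_ball,
      dist_add_self_left, norm_smul]
    rw [Real.norm_of_nonneg (by positivity)]
    have h1 : σ / (2 * N) * ‖x‖ ≤ σ / (2 * N) * N := by gcongr; exact hLN x hx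
    have h2 : σ / (2 * N) * N = σ / 2 := by field_simp
    linarith
  have hdetA1 : A1.det ≠ 0 := by
    have : (A1 : E →ₗ[ℝ] E) = (σ / (2 * N)) • LinearMap.id := rfl
    rw [ContinuousLinearMap.det, this, LinearMap.det_smul, LinearMap.det_id, mul_one]
    positivity
  have hcont : ContinuousOn (fun p : (E →L[ℝ] E) × E => |p.1.det|) A :=
    (continuous_abs.comp (ContinuousLinearMap.continuous_det.comp continuous_fst)).continuousOn
  obtain ⟨⟨A0, a0⟩, hmem, hmax⟩ := hcomp.exists_isMaxOn ⟨_, hA1⟩ hcont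
  have hdet0 : LinearMap.det (A0 : E →ₗ[ℝ] E) ≠ 0 := by
    intro h
    have := hmax hA1
    simp only [mem_ofPred_eq] at this
    rw [show A0.det = 0 from h, abs_zero] at this
    exact hdetA1 (abs_nonpos_iff.1 this)
  let T0 : E ≃ₗ[ℝ] E := LinearMap.equivOfDetNeZero _ hdet0
  have hT0 : ∀ x, T0 x = A0 x := fun x => rfl
  have hmemK : ∀ x : E, x ∈ (-T0.symm a0) +ᵥ (T0.symm '' K) ↔ A0 x + a0 ∈ K := by
    intro x
    rw [mem_vadd_set_iff_neg_vadd_mem, neg_neg, vadd_eq_add, ← hT0]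
    constructor
    · rintro ⟨y, hy, hyx⟩
      have : y = T0 x + a0 := by
        have := congrArg T0 hyx
        simpa [add_comm] using this
      rwa [← this]
    · intro h
      exact ⟨_, h, by simp [add_comm]⟩
  refine ⟨T0.symm, -T0.symm a0, fun x hx => (hmemK x).2 (hmem x hx), fun B b hB => ?_⟩
  have hmem2 : (A0.comp (LinearMap.toContinuousLinearMap B), A0 b + a0) ∈ A := by
    intro x hx
    have := (hmemK _).1 (hB x hx)
    simpa [add_assoc] using this
  have h1 := hmax hmem2
  simp only [mem_ofPred_eq] at h1
  have h2 : (A0.comp (LinearMap.toContinuousLinearMap B)).det = A0.det * LinearMap.det B := by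
    exact LinearMap.det_comp (A0 : E →ₗ[ℝ] E) B
  rw [h2, abs_mul] at h1
  have h3 : 0 < |A0.det| := abs_pos.2 hdet0
  have h4 : |LinearMap.det B| ≤ 1 := by
    by_contra hcon
    push Not at hcon
    nlinarith
  exact (le_abs_self _).trans h4

/-- First-order optimality of a position of maximal volume: no affine vector field `x ↦ B x + b` of
positive divergence points strictly into `K` at every contact pair. -/
theorem exists_contact_nonneg {K L : Set E} (hK : IsBody K) (hL : IsBody L)
    (h0 : (0 : E) ∈ interior L) (hLK : L ⊆ K)
    (hmax : ∀ (B : E →ₗ[ℝ] E) (b : E), (∀ x ∈ L, B x + b ∈ K) → LinearMap.det B ≤ 1)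
    (B : E →ₗ[ℝ] E) (b : E) (hB : 0 < LinearMap.trace ℝ E B) :
    ∃ x ∈ L, ∃ f ∈ polarBody K, ⟪x, f⟫ = 1 ∧ 0 ≤ ⟪B x + b, f⟫ := by
  by_contra! hcon
  have h0K : (0 : E) ∈ interior K := interior_mono hLK h0
  have hBc : Continuous B := B.continuous_of_finiteDimensional
  have hP : IsCompact (L ×ˢ polarBody K) := hL.compact.prod (isCompact_polarBody h0K)
  -- away from the contact pairs `⟪x, f⟫` stays below `1` by a fixed amount
  obtain ⟨η, hη, hηP⟩ : ∃ η > 0, ∀ p ∈ L ×ˢ polarBody K, 0 ≤ ⟪B p.1 + b, p.2⟫ →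
      ⟪p.1, p.2⟫ ≤ 1 - η := by
    have hcomp : IsCompact ((L ×ˢ polarBody K) ∩ {p : E × E | 0 ≤ ⟪B p.1 + b, p.2⟫}) :=
      hP.inter_right (isClosed_le continuous_const (by fun_prop))
    rcases ((L ×ˢ polarBody K) ∩ {p : E × E | 0 ≤ ⟪B p.1 + b, p.2⟫}).eq_empty_or_nonempty with
      he | hne
    · refine ⟨1, one_pos, fun p hp hp0 => absurd ⟨hp, hp0⟩
        (Set.eq_empty_iff_forall_notMem.1 he p)⟩
    · obtain ⟨p, hp, hpm⟩ := hcomp.exists_isMaxOn hne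
        (f := fun p : E × E => ⟪p.1, p.2⟫) (by fun_prop)
      refine ⟨1 - ⟪p.1, p.2⟫, ?_, fun q hq hq0 => ?_⟩
      · have h1 : ⟪p.1, p.2⟫ ≤ 1 := by
          rw [real_inner_comm]; exact hp.1.2 _ (hLK hp.1.1)
        have h2 : ⟪p.1, p.2⟫ ≠ 1 := fun h =>
          absurd hp.2 (not_le.2 (hcon _ hp.1.1 _ hp.1.2 h))
        exact sub_pos.2 (lt_of_le_of_ne h1 h2)
      · have := hpm ⟨hq, hq0⟩
        simp only [mem_ofPred_eq] at this
        linarith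
  obtain ⟨M, hM⟩ : ∃ M, ∀ p ∈ L ×ˢ polarBody K, ⟪B p.1 + b, p.2⟫ ≤ M := by
    obtain ⟨M, hM⟩ := (hP.image (f := fun p : E × E => ⟪B p.1 + b, p.2⟫) (by fun_prop)).bddAbove
    exact ⟨M, fun p hp => hM (mem_image_of_mem _ hp)⟩
  have hsmall : ∀ᶠ s in 𝓝[>] (0 : ℝ), s * M ≤ η := by
    have hc : Continuous fun s : ℝ => s * M := by fun_prop
    have h := hc.tendsto 0
    simp only [zero_mul] at h
    exact (h.mono_left nhdsWithin_le_nhds).eventually (ge_mem_nhds hη)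
  obtain ⟨s, hs1, hs2, hs0⟩ := ((eventually_one_lt_det_one_add_smul B hB).and
    (hsmall.and self_mem_nhdsWithin)).exists
  have hs0 : 0 < s := hs0
  refine absurd (hmax (1 + s • B) (s • b) fun x hx => ?_) (not_le.2 hs1)
  refine mem_of_forall_polarBody hK.convex hK.compact.isClosed (interior_subset h0K) fun f hf => ?_
  have hval : ⟪(1 + s • B) x + s • b, f⟫ = ⟪x, f⟫ + s * ⟪B x + b, f⟫ := by
    simp only [LinearMap.add_apply, Module.End.one_apply, LinearMap.smul_apply, inner_add_left,
      real_inner_smul_left]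
    ring
  rw [hval]
  by_cases h : 0 ≤ ⟪B x + b, f⟫
  · have h1 := hηP (x, f) ⟨hx, hf⟩ h
    have h2 := hM (x, f) ⟨hx, hf⟩
    simp only at h1 h2
    nlinarith
  · have h1 : ⟪x, f⟫ ≤ 1 := by rw [real_inner_comm]; exact hf _ (hLK hx)
    have : s * ⟪B x + b, f⟫ ≤ 0 := mul_nonpos_of_nonneg_of_nonpos hs0.le (not_le.1 h).le
    linarith

/-- A John decomposition of the identity for the pair `L ⊆ K`: weighted contact pairs `(x i, f i)`
with `∑ c i (x i ⊗ f i) = id` and `∑ c i f i = 0`. -/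
structure JohnDecomposition (K L : Set E) (ι : Type) [Fintype ι] where
  /-- the weights -/
  c : ι → ℝ
  /-- the contact points -/
  x : ι → E
  /-- the normals at the contact points, scaled to lie on the boundary of the polar body -/
  f : ι → E
  c_nonneg : ∀ i, 0 ≤ c i
  x_mem : ∀ i, x i ∈ L
  f_mem : ∀ i, f i ∈ polarBody K
  inner_eq_one : ∀ i, ⟪x i, f i⟫ = 1
  sum_c : ∑ i, c i = (Module.finrank ℝ E : ℝ)
  sum_f : ∑ i, c i • f i = 0
  sum_tensor : ∀ y, ∑ i, (c i * ⟪y, f i⟫) • x i = y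

/-- The rank one operator `y ↦ ⟪f, y⟫ x`. -/
noncomputable def rankOneOp (x f : E) : E →L[ℝ] E := (innerSL ℝ f).smulRight x

/-- John's theorem for a general pair of bodies: were the decomposition impossible, the point
`(id / dim, 0)` could be separated from the convex hull of all `(x ⊗ f, f)`, and the separating
functional would be a field forbidden by `exists_contact_nonneg`. -/
theorem exists_johnDecomposition {K L : Set E} (hK : IsBody K) (hL : IsBody L)
    (h0 : (0 : E) ∈ interior L) (hLK : L ⊆ K) (hE : 0 < Module.finrank ℝ E)
    (hmax : ∀ (B : E →ₗ[ℝ] E) (b : E), (∀ x ∈ L, B x + b ∈ K) → LinearMap.det B ≤ 1) :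
    ∃ (ι : Type) (_ : Fintype ι), Nonempty (JohnDecomposition K L ι) := by
  have h0K : (0 : E) ∈ interior K := interior_mono hLK h0
  obtain ⟨N, hN⟩ : ∃ N : ℝ, N = (Module.finrank ℝ E : ℝ) := ⟨_, rfl⟩
  have hNpos : 0 < N := by rw [hN]; exact_mod_cast hE
  let C : Set (E × E) := (L ×ˢ polarBody K) ∩ {p | ⟪p.1, p.2⟫ = 1}
  have hC : IsCompact C := (hL.compact.prod (isCompact_polarBody h0K)).inter_right
    (isClosed_eq (by fun_prop) continuous_const)
  let G : E × E → (E →L[ℝ] E) × E := fun p => (rankOneOp p.1 p.2, p.2)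
  have hG : Continuous G := by
    refine Continuous.prodMk ?_ continuous_snd
    have h : Continuous fun p : E × E =>
        ContinuousLinearMap.smulRightL ℝ E E (innerSL ℝ p.2) p.1 := by fun_prop
    exact h
  have hhull := isCompact_convexHull_of_isCompact (hC.image hG)
  have hmem : ((N⁻¹ • ContinuousLinearMap.id ℝ E, 0) : (E →L[ℝ] E) × E) ∈
      convexHull ℝ (G '' C) := by
    by_contra hnot
    obtain ⟨φ, u, hu, hφ⟩ := geometric_hahn_banach_closed_point (convex_convexHull ℝ _)
      hhull.isClosed hnot
    -- the functional is `(A, a) ↦ tr (Bᵀ A) + ⟪b, a⟫`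
    let β : E →ₗ[ℝ] E →ₗ[ℝ] ℝ := LinearMap.mk₂ ℝ (fun x f => φ (rankOneOp x f, 0))
      (fun x y f => by
        rw [← map_add]; congr 1; ext <;> simp [rankOneOp])
      (fun r x f => by
        rw [← map_smul]; congr 1; ext <;> simp [rankOneOp, smul_smul, mul_comm])
      (fun x f g => by
        rw [← map_add]; congr 1; ext <;> simp [rankOneOp, add_smul])
      (fun r x f => by
        rw [← map_smul]; congr 1; ext <;> simp [rankOneOp, smul_smul])
    let B : E →ₗ[ℝ] E := (InnerProductSpace.toDual ℝ E).symm.toLinearEquiv.toLinearMap ∘ₗ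
      LinearMap.toContinuousLinearMap.toLinearMap ∘ₗ β
    have hBβ : ∀ x f, ⟪B x, f⟫ = φ (rankOneOp x f, 0) := by
      intro x f
      exact InnerProductSpace.toDual_symm_apply
    let ψ : E →L[ℝ] ℝ := φ.comp (ContinuousLinearMap.inr ℝ (E →L[ℝ] E) E)
    let b := (InnerProductSpace.toDual ℝ E).symm ψ
    have hb : ∀ f, ⟪b, f⟫ = φ (0, f) := fun f => InnerProductSpace.toDual_symm_apply
    have htr : LinearMap.trace ℝ E B = φ (ContinuousLinearMap.id ℝ E, 0) := by
      let e := stdOrthonormalBasis ℝ E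
      rw [LinearMap.trace_eq_sum_inner B e]
      have : ∀ i, ⟪e i, B (e i)⟫ = φ (rankOneOp (e i) (e i), 0) := fun i => by
        rw [real_inner_comm, hBβ]
      simp only [this]
      rw [← map_sum]
      congr 1
      ext1
      · ext1 y
        simp only [Prod.fst_sum, sum_apply, ContinuousLinearMap.id_apply]
        exact e.sum_repr' y
      · simp [Prod.snd_sum]
    have hutr : u < N⁻¹ * LinearMap.trace ℝ E B := by
      rw [htr, ← smul_eq_mul, ← map_smul]
      simpa using hφ
    obtain ⟨x, hx, f, hf, hxf, hle⟩ := exists_contact_nonneg hK hL h0 hLK hmax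
      (B - u • LinearMap.id) b (by
        rw [map_sub, map_smul, LinearMap.trace_id, smul_eq_mul]
        rw [inv_mul_eq_div, lt_div_iff₀ hNpos, hN] at hutr
        linarith)
    have h1 := hu (G (x, f)) (subset_convexHull ℝ _ ⟨(x, f), ⟨⟨hx, hf⟩, hxf⟩, rfl⟩)
    have h2 : φ (G (x, f)) = ⟪B x, f⟫ + ⟪b, f⟫ := by
      rw [hBβ, hb, ← map_add]; simp [G]
    have h3 : ⟪(B - u • (LinearMap.id : E →ₗ[ℝ] E)) x + b, f⟫ = ⟪B x, f⟫ - u * ⟪x, f⟫ + ⟪b, f⟫ := by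
      simp [inner_add_left, inner_sub_left, real_inner_smul_left]
    rw [h3, hxf] at hle
    linarith
  obtain ⟨ι, hι, w, z, hw, hw1, hz, hsum⟩ := mem_convexHull_iff_exists_fintype.1 hmem
  choose p hp hpz using hz
  refine ⟨ι, hι, ⟨⟨fun i => N * w i, fun i => (p i).1, fun i => (p i).2,
    fun i => mul_nonneg hNpos.le (hw i), fun i => (hp i).1.1, fun i => (hp i).1.2,
    fun i => (hp i).2, ?_, ?_, fun y => ?_⟩⟩⟩
  · rw [← Finset.mul_sum, hw1, mul_one, hN]
  · have h := congrArg Prod.snd hsum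
    simp only [← hpz, Prod.snd_sum, Prod.smul_snd, G] at h
    simp only [mul_smul, ← Finset.smul_sum, h, smul_zero]
  · have h := congrArg (fun q => q.1 y) hsum
    simp only [← hpz, Prod.fst_sum, Prod.smul_fst, G, sum_apply,
      smul_apply, ContinuousLinearMap.id_apply, rankOneOp, ContinuousLinearMap.smulRight_apply,
      innerSL_apply_apply] at h
    have h2 : ∀ i, (N * w i * ⟪y, (p i).2⟫) • (p i).1 = N • (w i • ⟪(p i).2, y⟫ • (p i).1) := by
      intro i
      rw [real_inner_comm, smul_smul, smul_smul]
    simp only [h2, ← Finset.smul_sum, h]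
    rw [smul_smul, mul_inv_cancel₀ hNpos.ne', one_smul]

end

/-! ### Affine invariance of the distances -/

theorem sandwich_iff {K L : Set E} {r : ℝ} : Sandwich K L r ↔ ∃ (T : E ≃ₗ[ℝ] E) (u v : E),
    (∀ x ∈ K, ∃ y ∈ L, T (v + y) = u + x) ∧ ∀ y ∈ L, ∃ x ∈ K, T (v + y) = r • (u + x) := by
  simp only [Sandwich]
  refine exists_congr fun T => exists_congr fun u => exists_congr fun v => and_congr ?_ ?_
  · rw [← image_vadd, ← image_vadd, image_image]
    constructor
    · intro h x hx
      exact h ⟨x, hx, rfl⟩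
    · rintro h _ ⟨x, hx, rfl⟩
      exact h x hx
  · rw [← image_vadd, ← image_vadd, image_image, ← image_smul, image_image]
    constructor
    · intro h y hy
      obtain ⟨x, hx, h⟩ := h ⟨y, hy, rfl⟩
      exact ⟨x, hx, h.symm⟩
    · rintro h _ ⟨y, hy, rfl⟩
      obtain ⟨x, hx, h⟩ := h y hy
      exact ⟨x, hx, h.symm⟩

theorem mem_affine_image {K : Set E} {T : E ≃ₗ[ℝ] E} {a x : E} :
    x ∈ a +ᵥ (T '' K) ↔ ∃ y ∈ K, a + T y = x := by
  rw [← image_vadd, image_image]; rfl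

theorem sandwich_affine_image_left {K L : Set E} (T : E ≃ₗ[ℝ] E) (a : E) (r : ℝ) :
    Sandwich (a +ᵥ (T '' K)) L r ↔ Sandwich K L r := by
  simp only [sandwich_iff, mem_affine_image]
  constructor
  · rintro ⟨S, u, v, h1, h2⟩
    refine ⟨S.trans T.symm, T.symm (u + a), v, fun x hx => ?_, fun y hy => ?_⟩
    · obtain ⟨y, hy, h⟩ := h1 _ ⟨x, hx, rfl⟩
      refine ⟨y, hy, T.injective ?_⟩
      simp only [LinearEquiv.trans_apply, LinearEquiv.apply_symm_apply, map_add] at h ⊢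
      rw [h]; abel
    · obtain ⟨_, ⟨x, hx, rfl⟩, h⟩ := h2 y hy
      refine ⟨x, hx, T.injective ?_⟩
      simp only [LinearEquiv.trans_apply, LinearEquiv.apply_symm_apply, map_add, map_smul] at h ⊢
      rw [h]; simp only [add_assoc]
  · rintro ⟨S, u, v, h1, h2⟩
    refine ⟨S.trans T, T u - a, v, ?_, fun y hy => ?_⟩
    · rintro _ ⟨x, hx, rfl⟩
      obtain ⟨y, hy, h⟩ := h1 x hx
      refine ⟨y, hy, ?_⟩
      rw [LinearEquiv.trans_apply, h, map_add]; abel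
    · obtain ⟨x, hx, h⟩ := h2 y hy
      refine ⟨_, ⟨x, hx, rfl⟩, ?_⟩
      rw [LinearEquiv.trans_apply, h, map_smul, map_add]
      congr 1; abel

theorem sandwich_affine_image_right {K L : Set E} (T : E ≃ₗ[ℝ] E) (a : E) (r : ℝ) :
    Sandwich K (a +ᵥ (T '' L)) r ↔ Sandwich K L r := by
  simp only [sandwich_iff, mem_affine_image]
  constructor
  · rintro ⟨S, u, v, h1, h2⟩
    refine ⟨T.trans S, u, T.symm (v + a), fun x hx => ?_, fun y hy => ?_⟩
    · obtain ⟨_, ⟨y, hy, rfl⟩, h⟩ := h1 x hx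
      refine ⟨y, hy, ?_⟩
      rw [← h]; simp [add_assoc]
    · obtain ⟨x, hx, h⟩ := h2 _ ⟨y, hy, rfl⟩
      refine ⟨x, hx, ?_⟩
      rw [← h]; simp [add_assoc]
  · rintro ⟨S, u, v, h1, h2⟩
    refine ⟨T.symm.trans S, u, T v - a, fun x hx => ?_, ?_⟩
    · obtain ⟨y, hy, h⟩ := h1 x hx
      refine ⟨_, ⟨y, hy, rfl⟩, ?_⟩
      rw [← h]
      simp only [map_sub, map_add, LinearEquiv.trans_apply, LinearEquiv.symm_apply_apply]
      abel
    · rintro _ ⟨y, hy, rfl⟩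
      obtain ⟨x, hx, h⟩ := h2 y hy
      refine ⟨x, hx, ?_⟩
      rw [← h]
      simp only [map_sub, map_add, LinearEquiv.trans_apply, LinearEquiv.symm_apply_apply]
      abel

theorem distG_affine_image_left (K L : Set E) (T : E ≃ₗ[ℝ] E) (a : E) :
    distG (a +ᵥ (T '' K)) L = distG K L := by
  simp only [distG, sandwich_affine_image_left]

theorem distG_affine_image_right (K L : Set E) (T : E ≃ₗ[ℝ] E) (a : E) :
    distG K (a +ᵥ (T '' L)) = distG K L := by
  simp only [distG, sandwich_affine_image_right]

theorem distBM_affine_image_left (K L : Set E) (T : E ≃ₗ[ℝ] E) (a : E) :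
    distBM (a +ᵥ (T '' K)) L = distBM K L := by
  simp only [distBM, sandwich_affine_image_left]

theorem distBM_le {K L : Set E} {r : ℝ} (hr : 0 < r) (h : Sandwich K L r) : distBM K L ≤ r :=
  csInf_le ⟨0, fun _ hx => hx.1.le⟩ ⟨hr, h⟩

/-- If `L ⊆ K ⊆ y - ρ L`, moving the center of the homothety `x ↦ y - ρ x` to the origin turns this
into a sandwich with the negative ratio `-ρ`. -/
theorem distG_le_of_subset {K L : Set E} {ρ : ℝ} (hρ : 0 < ρ) (hLK : L ⊆ K) (y : E)
    (h : ∀ x ∈ K, ∃ l ∈ L, x = y - ρ • l) : distG K L ≤ ρ := by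
  refine csInf_le ⟨0, ?_⟩ ⟨-ρ, by rw [abs_neg, abs_of_pos hρ], ?_⟩
  · rintro _ ⟨r, rfl, _⟩; exact abs_nonneg r
  have hu : -ρ ≠ 0 := neg_ne_zero.2 hρ.ne'
  have h1 : (1 + ρ) ≠ 0 := by positivity
  rw [sandwich_iff]
  refine ⟨LinearEquiv.smulOfNeZero ℝ E (-ρ) hu, -(1 + ρ)⁻¹ • y, -(1 + ρ)⁻¹ • y,
    fun x hx => ?_, fun l hl => ⟨l, hLK hl, rfl⟩⟩
  obtain ⟨l, hl, rfl⟩ := h x hx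
  refine ⟨l, hl, ?_⟩
  have h2 : (1 + ρ)⁻¹ * (1 + ρ) = 1 := inv_mul_cancel₀ h1
  change (-ρ) • (-(1 + ρ)⁻¹ • y + l) = _
  match_scalars <;> linarith

/-! ### Consequences of the John decomposition -/

theorem JohnDecomposition.sum_c_inner {K L : Set E} {ι : Type} [Fintype ι]
    (J : JohnDecomposition K L ι) (y : E) : ∑ i, J.c i * ⟪y, J.f i⟫ = 0 := by
  have h := congrArg (fun z => ⟪y, z⟫) J.sum_f
  simpa only [inner_sum, real_inner_smul_right, inner_zero_right] using h

theorem JohnDecomposition.sum_c_inner_inner {K L : Set E} {ι : Type} [Fintype ι]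
    (J : JohnDecomposition K L ι) (y h : E) :
    ∑ i, J.c i * ⟪y, J.f i⟫ * ⟪J.x i, h⟫ = ⟪y, h⟫ := by
  have h := congrArg (fun z => ⟪z, h⟫) (J.sum_tensor y)
  simpa only [sum_inner, real_inner_smul_left] using h

theorem JohnDecomposition.one_sub_nonneg {K L : Set E} {ι : Type} [Fintype ι]
    (J : JohnDecomposition K L ι) {y : E} (hy : y ∈ K) (i : ι) : 0 ≤ 1 - ⟪y, J.f i⟫ := by
  have := J.f_mem i y hy
  rw [real_inner_comm] at this
  linarith

/-- For a point `y` of `K` the numbers `c i (1 - ⟪y, f i⟫)` are nonnegative weights of total mass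
the dimension. -/
theorem JohnDecomposition.sum_weights {K L : Set E} {ι : Type} [Fintype ι]
    (J : JohnDecomposition K L ι) (y : E) :
    ∑ i, J.c i * (1 - ⟪y, J.f i⟫) = Module.finrank ℝ E := by
  simp only [mul_sub, mul_one, Finset.sum_sub_distrib, J.sum_c_inner, sub_zero, J.sum_c]

/-- If `-L ⊆ a L`, the body `K` and its reflection `-K` lie in `dim (1 + a) L`, in the sense of
support functions. -/
theorem JohnDecomposition.abs_inner_le {K L : Set E} {ι : Type} [Fintype ι]
    (J : JohnDecomposition K L ι) {a : ℝ} (ha : 0 ≤ a) (hneg : ∀ x ∈ L, ∃ y ∈ L, -x = a • y)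
    {h : E} {t : ℝ} (ht : ∀ l ∈ L, ⟪l, h⟫ ≤ t) {y : E} (hy : y ∈ K) :
    |⟪y, h⟫| ≤ Module.finrank ℝ E * (1 + a) * t := by
  have hx : ∀ i, ⟪J.x i, h⟫ ≤ t := fun i => ht _ (J.x_mem i)
  have hx' : ∀ i, -⟪J.x i, h⟫ ≤ a * t := fun i => by
    obtain ⟨z, hz, hxz⟩ := hneg _ (J.x_mem i)
    rw [← inner_neg_left, hxz, real_inner_smul_left]
    exact mul_le_mul_of_nonneg_left (ht z hz) ha
  have hw := J.sum_weights y
  have hw0 : ∀ i, 0 ≤ J.c i * (1 - ⟪y, J.f i⟫) := fun i =>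
    mul_nonneg (J.c_nonneg i) (J.one_sub_nonneg hy i)
  have hsplit : ⟪y, h⟫ = ∑ i, J.c i * ⟪J.x i, h⟫ -
      ∑ i, J.c i * (1 - ⟪y, J.f i⟫) * ⟪J.x i, h⟫ := by
    rw [← Finset.sum_sub_distrib, ← J.sum_c_inner_inner y h]
    exact Finset.sum_congr rfl fun i _ => by ring
  have h1 : ∑ i, J.c i * ⟪J.x i, h⟫ ≤ Module.finrank ℝ E * t := by
    rw [← J.sum_c, Finset.sum_mul]
    exact Finset.sum_le_sum fun i _ => mul_le_mul_of_nonneg_left (hx i) (J.c_nonneg i)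
  have h2 : -∑ i, J.c i * ⟪J.x i, h⟫ ≤ Module.finrank ℝ E * (a * t) := by
    rw [← J.sum_c, Finset.sum_mul, ← Finset.sum_neg_distrib]
    refine Finset.sum_le_sum fun i _ => ?_
    rw [← mul_neg]
    exact mul_le_mul_of_nonneg_left (hx' i) (J.c_nonneg i)
  have h3 : ∑ i, J.c i * (1 - ⟪y, J.f i⟫) * ⟪J.x i, h⟫ ≤ Module.finrank ℝ E * t := by
    rw [← hw, Finset.sum_mul]
    exact Finset.sum_le_sum fun i _ => mul_le_mul_of_nonneg_left (hx i) (hw0 i)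
  have h4 : -∑ i, J.c i * (1 - ⟪y, J.f i⟫) * ⟪J.x i, h⟫ ≤ Module.finrank ℝ E * (a * t) := by
    rw [← hw, Finset.sum_mul, ← Finset.sum_neg_distrib]
    refine Finset.sum_le_sum fun i _ => ?_
    rw [← mul_neg]
    exact mul_le_mul_of_nonneg_left (hx' i) (hw0 i)
  rw [abs_le]
  constructor <;> linarith

theorem JohnDecomposition.sum_mul_one_sub {K L : Set E} {ι : Type} [Fintype ι]
    (J : JohnDecomposition K L ι) (p g : E) :
    ∑ i, J.c i * (1 - ⟪p, J.f i⟫) * (1 - ⟪J.x i, g⟫) =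
      Module.finrank ℝ E - ∑ i, J.c i * ⟪J.x i, g⟫ + ⟪p, g⟫ := by
  rw [← J.sum_c_inner_inner p g, ← J.sum_weights p, ← Finset.sum_sub_distrib,
    ← Finset.sum_add_distrib]
  exact Finset.sum_congr rfl fun i _ => by ring

/-- The averaged defect identity: it bounds how far the normals `g j` are from the contact normals
`f i` seen from the points `p j`. -/
theorem JohnDecomposition.sum_sum_mul_one_sub {K L : Set E} {ι κ : Type} [Fintype ι] [Fintype κ]
    (J : JohnDecomposition K L ι) {w : κ → ℝ} {p g : κ → E} (hw : ∑ j, w j = 1)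
    (hg : ∑ j, w j • g j = 0) :
    ∑ j, w j * ∑ i, J.c i * (1 - ⟪p j, J.f i⟫) * (1 - ⟪J.x i, g j⟫) =
      Module.finrank ℝ E + ∑ j, w j * ⟪p j, g j⟫ := by
  simp only [J.sum_mul_one_sub]
  simp only [mul_add, mul_sub, Finset.sum_add_distrib, Finset.sum_sub_distrib,
    ← Finset.sum_mul, hw, one_mul, Finset.mul_sum]
  rw [Finset.sum_comm]
  have : ∀ i, ∑ j, w j * (J.c i * ⟪J.x i, g j⟫) = 0 := fun i => by
    have h := congrArg (fun z => ⟪J.x i, z⟫) hg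
    simp only [inner_sum, real_inner_smul_right, inner_zero_right] at h
    rw [← mul_zero (J.c i), ← h, Finset.mul_sum]
    exact Finset.sum_congr rfl fun j _ => by ring
  simp [this]

/-! ### A dual certificate for the circumscribed homothet -/

theorem eq_zero_of_forall_inner_nonpos {L : Set E} (h0 : (0 : E) ∈ interior L) {h : E}
    (hh : ∀ l ∈ L, ⟪l, h⟫ ≤ 0) : h = 0 := by
  obtain ⟨ρ, hρ, hball⟩ := Metric.isOpen_iff.1 isOpen_interior 0 h0
  by_contra hne
  have hn : 0 < ‖h‖ := norm_pos_iff.2 hne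
  have h1 := hh ((ρ / 2 / ‖h‖) • h) (interior_subset (hball (by
    rw [mem_ball_zero_iff, norm_smul, Real.norm_of_nonneg (by positivity),
      div_mul_cancel₀ _ hn.ne']
    linarith)))
  rw [real_inner_smul_left, real_inner_self_eq_norm_sq] at h1
  have : 0 < ρ / 2 / ‖h‖ * ‖h‖ ^ 2 := by positivity
  linarith

section

variable [FiniteDimensional ℝ E]

/-- If finitely many translates `p j + ρ L` have no common point, this is witnessed by elements
`g j` of the polar body. -/
theorem exists_certificate_of_iInter_eq_empty {κ : Type} [Fintype κ] [DecidableEq κ] {L : Set E}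
    (hL : IsBody L) (h0 : (0 : E) ∈ interior L) {ρ : ℝ} (p : κ → E)
    (hemp : ∀ y : E, ∃ j, ∀ l ∈ L, y ≠ p j + ρ • l) :
    ∃ (w : κ → ℝ) (g : κ → E), (∀ j, 0 ≤ w j) ∧ ∑ j, w j = 1 ∧ (∀ j, g j ∈ polarBody L) ∧
      ∑ j, w j • g j = 0 ∧ ρ < ∑ j, w j * (-⟪p j, g j⟫) := by
  have h0L : (0 : E) ∈ L := interior_subset h0
  let A : Set (κ → E) := Set.pi univ fun j => (fun l => p j + ρ • l) '' L
  have hAcomp : IsCompact A := isCompact_univ_pi fun j => hL.compact.image (by fun_prop)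
  have hAconv : Convex ℝ A := convex_pi fun j _ => by
    have : (fun l => p j + ρ • l) '' L = p j +ᵥ ρ • L := by
      rw [← image_vadd, ← image_smul, image_image]; rfl
    rw [this]
    exact (hL.convex.smul ρ).vadd _
  let cst : E →ₗ[ℝ] (κ → E) := LinearMap.pi fun _ => LinearMap.id
  let D : Submodule ℝ (κ → E) := LinearMap.range cst
  have hdisj : Disjoint A (D : Set (κ → E)) := by
    rw [Set.disjoint_left]
    rintro z hz ⟨y, rfl⟩
    obtain ⟨j, hj⟩ := hemp y
    obtain ⟨l, hl, h⟩ := hz j (mem_univ j)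
    exact hj l hl h.symm
  obtain ⟨φ, u, v, hu, huv, hv⟩ := geometric_hahn_banach_compact_closed hAconv hAcomp D.convex
    D.closed_of_finiteDimensional hdisj
  have hv0 : v < 0 := by simpa using hv 0 D.zero_mem
  have hφD : ∀ y, φ (cst y) = 0 := by
    intro y
    by_contra hne
    have := hv (cst ((v / φ (cst y)) • y)) ⟨_, rfl⟩
    rw [map_smul, map_smul, smul_eq_mul, div_mul_cancel₀ _ hne] at this
    exact lt_irrefl _ this
  let h : κ → E := fun j => (InnerProductSpace.toDual ℝ E).symm
    (φ.comp (ContinuousLinearMap.single ℝ (fun _ : κ => E) j))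
  have hh : ∀ j y, ⟪y, h j⟫ = φ (Pi.single j y) := fun j y => by
    rw [real_inner_comm]
    exact InnerProductSpace.toDual_symm_apply
  have hφ : ∀ z, φ z = ∑ j, ⟪z j, h j⟫ := fun z => by
    simp only [hh]
    rw [← map_sum, Finset.univ_sum_single]
  have hsum : ∑ j, h j = 0 := by
    refine ext_inner_left ℝ fun y => ?_
    rw [inner_sum, inner_zero_right, ← hφD y, hφ]
    rfl
  have hmax : ∀ j, ∃ l ∈ L, ∀ l' ∈ L, ⟪l', h j⟫ ≤ ⟪l, h j⟫ := fun j => by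
    obtain ⟨l, hl, hm⟩ := hL.compact.exists_isMaxOn ⟨0, h0L⟩
      (f := fun l => ⟪l, h j⟫) (by fun_prop)
    exact ⟨l, hl, fun l' hl' => hm hl'⟩
  choose l hl hlm using hmax
  set μ : κ → ℝ := fun j => ⟪l j, h j⟫ with hμ
  have hμ0 : ∀ j, 0 ≤ μ j := fun j => by simpa using hlm j 0 h0L
  have hμz : ∀ j, μ j = 0 → h j = 0 := fun j hj =>
    eq_zero_of_forall_inner_nonpos h0 fun l' hl' => (hlm j l' hl').trans hj.le
  have hneg : ∑ j, ⟪p j, h j⟫ + ρ * ∑ j, μ j < 0 := by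
    have h1 := hu (fun j => p j + ρ • l j) fun j _ => ⟨l j, hl j, rfl⟩
    rw [hφ] at h1
    simp only [inner_add_left, real_inner_smul_left, Finset.sum_add_distrib,
      ← Finset.mul_sum] at h1
    simp only [hμ]
    linarith
  have hM : 0 < ∑ j, μ j := by
    refine lt_of_le_of_ne (Finset.sum_nonneg fun j _ => hμ0 j) fun hz => ?_
    have hall := (Finset.sum_eq_zero_iff_of_nonneg fun j _ => hμ0 j).1 hz.symm
    have : ∀ j, ⟪p j, h j⟫ = 0 := fun j => by
      rw [hμz j (hall j (Finset.mem_univ j)), inner_zero_right]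
    simp [this, ← hz] at hneg
  have hμg : ∀ j, μ j • ((μ j)⁻¹ • h j) = h j := fun j => by
    by_cases hj : μ j = 0
    · rw [hj, hμz j hj]; simp
    · rw [smul_smul, mul_inv_cancel₀ hj, one_smul]
  set M := ∑ j, μ j with hMdef
  refine ⟨fun j => M⁻¹ * μ j, fun j => (μ j)⁻¹ • h j,
    fun j => mul_nonneg (inv_nonneg.2 hM.le) (hμ0 j), ?_, fun j y hy => ?_, ?_, ?_⟩
  · rw [← Finset.mul_sum, ← hMdef, inv_mul_cancel₀ hM.ne']
  · rw [real_inner_smul_left, real_inner_comm]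
    by_cases hj : μ j = 0
    · rw [hj]; simp
    · rw [inv_mul_le_iff₀ (lt_of_le_of_ne (hμ0 j) (Ne.symm hj)), mul_one]
      exact hlm j y hy
  · simp only [mul_smul, ← Finset.smul_sum, hμg, hsum, smul_zero]
  · have h2 : ∀ j, M⁻¹ * μ j * (-⟪p j, (μ j)⁻¹ • h j⟫) = M⁻¹ * (-⟪p j, h j⟫) := fun j => by
      rw [mul_assoc, ← mul_neg_one, ← mul_assoc (μ j), ← real_inner_smul_right, hμg, mul_neg_one]
    simp only [h2]
    rw [← Finset.mul_sum, Finset.sum_neg_distrib, lt_inv_mul_iff₀ hM]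
    linarith

/-- If no translate of `-ρ L` contains `K`, then by Helly's theorem already `dim + 1` points of `K`
do not fit into a translate, and separation yields the dual certificate. -/
theorem exists_certificate {K L : Set E} (hL : IsBody L)
    (h0 : (0 : E) ∈ interior L) {ρ : ℝ}
    (hno : ∀ y : E, ∃ x ∈ K, ∀ l ∈ L, x ≠ y - ρ • l) {n : ℕ} (hn : Module.finrank ℝ E = n) :
    ∃ (p g : Fin (n + 1) → E) (w : Fin (n + 1) → ℝ), (∀ j, p j ∈ K) ∧ (∀ j, g j ∈ polarBody L) ∧
      (∀ j, 0 ≤ w j) ∧ ∑ j, w j = 1 ∧ ∑ j, w j • g j = 0 ∧ ρ < ∑ j, w j * (-⟪p j, g j⟫) := by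
  classical
  let F : K → Set E := fun p => (fun l => (p : E) + ρ • l) '' L
  have hFcomp : ∀ p, IsCompact (F p) := fun p => hL.compact.image (by fun_prop)
  have hFconv : ∀ p, Convex ℝ (F p) := fun p => by
    have : F p = (p : E) +ᵥ ρ • L := by
      rw [← image_vadd, ← image_smul, image_image]; rfl
    rw [this]
    exact (hL.convex.smul ρ).vadd _
  obtain ⟨I, hIcard, hI⟩ : ∃ I : Finset K, I.card ≤ n + 1 ∧ ¬ (⋂ i ∈ I, F i).Nonempty := by
    by_contra! hcon
    obtain ⟨y, hy⟩ := Convex.helly_theorem_compact' hFconv hFcomp (fun I hc => hcon I (hn ▸ hc))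
    obtain ⟨x, hx, hxl⟩ := hno y
    obtain ⟨l, hl, h⟩ := mem_iInter.1 hy ⟨x, hx⟩
    exact hxl l hl (by rw [← h]; simp)
  have hIne : I.Nonempty := by
    by_contra hemp
    rw [Finset.not_nonempty_iff_eq_empty] at hemp
    subst hemp
    exact hI ⟨0, by simp⟩
  obtain ⟨i0, hi0⟩ := hIne
  obtain ⟨e⟩ : Nonempty (I ↪ Fin (n + 1)) :=
    Function.Embedding.nonempty_of_card_le (by simpa using hIcard)
  let q : Fin (n + 1) → K := Function.extend e (fun i => (i : K)) fun _ => i0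
  obtain ⟨w, g, hw, hw1, hg, hg0, hlt⟩ := exists_certificate_of_iInter_eq_empty hL h0 (ρ := ρ)
    (fun j => (q j : E)) (fun y => by
      by_contra! hcon
      refine hI ⟨y, mem_iInter₂.2 fun i hi => ?_⟩
      obtain ⟨l, hl, h⟩ := hcon (e ⟨i, hi⟩)
      simp only [q, e.injective.extend_apply] at h
      exact ⟨l, hl, h.symm⟩)
  exact ⟨fun j => q j, g, w, fun j => (q j).2, hg, hw, hw1, hg0, hlt⟩

end

/-! ### Nearly dual systems of points and functionals -/

/-- Let `b` have row sums `1`, diagonal entries at least `1 - η` and nearly nonnegative entries. A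
vector of total mass `1` whose image under `b` is nearly nonnegative is nearly nonnegative: at its
least entry the diagonal of `b` dominates. -/
theorem coeff_ge_of_nearly_identity {n : ℕ} {b : Fin (n + 1) → Fin (n + 1) → ℝ}
    {w α : Fin (n + 1) → ℝ} {η τ : ℝ} (hη : 0 ≤ η) (hτ : 0 ≤ τ) (hw : ∀ k, 0 ≤ w k)
    (hw1 : ∑ k, w k = 1) (hrow : ∀ j, ∑ k, b j k = 1) (hdiag : ∀ j, 1 - η ≤ b j j)
    (hlow : ∀ j k, -(τ * w k) ≤ b j k) (hsmall : η + (2 * n + 1) * (η + τ) ≤ 1 / 2)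
    (hα : ∑ j, α j = 1) (himg : ∀ k, -(τ * w k) ≤ ∑ j, α j * b j k) (k : Fin (n + 1)) :
    -(2 * (η + 2 * τ)) ≤ α k := by
  have hτw : ∀ k, τ * w k ≤ τ := fun k => by
    have : w k ≤ 1 := by
      rw [← hw1]; exact Finset.single_le_sum (fun k _ => hw k) (Finset.mem_univ k)
    exact mul_le_of_le_one_right hτ this
  have hoff : ∀ j m, j ≠ m → |b j m| ≤ η + τ := by
    intro j m hjm
    have h1 : ∑ k, b j k = b j j + (b j m + ∑ k ∈ (Finset.univ.erase j).erase m, b j k) := by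
      rw [Finset.add_sum_erase _ _ (Finset.mem_erase.2 ⟨hjm.symm, Finset.mem_univ _⟩),
        Finset.add_sum_erase _ _ (Finset.mem_univ _)]
    have h2 : ∑ k ∈ (Finset.univ.erase j).erase m, -(τ * w k) ≤
        ∑ k ∈ (Finset.univ.erase j).erase m, b j k := Finset.sum_le_sum fun k _ => hlow j k
    have h3 : ∑ k ∈ (Finset.univ.erase j).erase m, w k ≤ 1 := by
      rw [← hw1]
      exact Finset.sum_le_sum_of_subset_of_nonneg (Finset.subset_univ _) fun k _ _ => hw k
    rw [Finset.sum_neg_distrib, ← Finset.mul_sum] at h2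
    have h4 := mul_le_mul_of_nonneg_left h3 hτ
    have h5 := hrow j
    have h6 := hdiag j
    have h7 := hlow j m
    have h8 := hτw m
    rw [abs_le]
    constructor <;> linarith
  obtain ⟨m, -, hm⟩ := Finset.exists_min_image Finset.univ α ⟨0, Finset.mem_univ _⟩
  refine le_trans ?_ (hm k (Finset.mem_univ k))
  rcases le_or_gt 0 (α m) with hαm | hαm
  · have : 0 ≤ 2 * (η + 2 * τ) := by positivity
    linarith
  have h1 : ∑ j, α j * b j m = α m * b m m + ∑ j ∈ Finset.univ.erase m, α j * b j m :=
    (Finset.add_sum_erase _ _ (Finset.mem_univ m)).symm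
  have h2 : ∑ j ∈ Finset.univ.erase m, α j * b j m ≤
      ∑ j ∈ Finset.univ.erase m, (α j - 2 * α m) * (η + τ) := by
    refine Finset.sum_le_sum fun j hj => ?_
    have h3 := hoff j m (Finset.ne_of_mem_erase hj)
    have h4 : |α j| ≤ α j - 2 * α m := by
      have := hm j (Finset.mem_univ j)
      rw [abs_le]; constructor <;> linarith
    calc α j * b j m ≤ |α j * b j m| := le_abs_self _
      _ = |α j| * |b j m| := abs_mul _ _
      _ ≤ _ := mul_le_mul h4 h3 (abs_nonneg _) ((abs_nonneg _).trans h4)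
  have h5 : ∑ j ∈ Finset.univ.erase m, (α j - 2 * α m) * (η + τ) =
      (1 - α m - 2 * n * α m) * (η + τ) := by
    rw [← Finset.sum_mul, Finset.sum_sub_distrib, Finset.sum_const, Finset.card_erase_of_mem
      (Finset.mem_univ m), Finset.card_univ, Fintype.card_fin, Nat.add_sub_cancel, nsmul_eq_mul,
      Finset.sum_erase_eq_sub (Finset.mem_univ m), hα]
    ring
  have h6 := himg m
  have h7 := hτw m
  have h8 : α m * b m m ≤ α m * (1 - η) := mul_le_mul_of_nonpos_left (hdiag m) hαm.le
  have h9 : (-α m) * (η + (2 * n + 1) * (η + τ)) ≤ (-α m) * (1 / 2) :=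
    mul_le_mul_of_nonneg_left hsmall (by linarith)
  have h10 : α m * (1 - η) + (1 - α m - 2 * n * α m) * (η + τ) =
      α m + (η + τ) + (-α m) * (η + (2 * n + 1) * (η + τ)) := by ring
  linarith

/-- Points `p j` nearly dual to the functionals `x ↦ w k (1 - ⟪x, g k⟫)` (which sum to `1` and are
nearly nonnegative on `K`) are affinely independent, and all points of `K` have nearly nonnegative
barycentric coordinates with respect to them. -/
theorem affineIndependent_and_coeff_ge {n : ℕ} {K : Set E} {p g : Fin (n + 1) → E}
    {w : Fin (n + 1) → ℝ} {η τ : ℝ} (hη : 0 ≤ η) (hτ : 0 ≤ τ) (hw : ∀ k, 0 ≤ w k)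
    (hw1 : ∑ k, w k = 1) (hg : ∑ k, w k • g k = 0) (hp : ∀ j, p j ∈ K)
    (hdiag : ∀ j, 1 - η ≤ w j * (1 - ⟪p j, g j⟫))
    (hlow : ∀ x ∈ K, ∀ k, -(τ * w k) ≤ w k * (1 - ⟪x, g k⟫))
    (hsmall : η + (2 * n + 1) * (η + τ) ≤ 1 / 2) :
    AffineIndependent ℝ p ∧ ∀ α : Fin (n + 1) → ℝ, ∑ j, α j = 1 → ∑ j, α j • p j ∈ K →
      ∀ k, -(2 * (η + 2 * τ)) ≤ α k := by
  have hrow : ∀ x : E, ∑ k, w k * (1 - ⟪x, g k⟫) = 1 := fun x => by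
    have h := congrArg (fun z => ⟪x, z⟫) hg
    simp only [inner_sum, real_inner_smul_right, inner_zero_right] at h
    simp only [mul_sub, mul_one, Finset.sum_sub_distrib, hw1, h, sub_zero]
  have hcomb : ∀ (α : Fin (n + 1) → ℝ) (k), ∑ j, α j * (w k * (1 - ⟪p j, g k⟫)) =
      w k * (∑ j, α j - ⟪∑ j, α j • p j, g k⟫) := fun α k => by
    simp only [sum_inner, real_inner_smul_left]
    rw [← Finset.sum_sub_distrib, Finset.mul_sum]
    exact Finset.sum_congr rfl fun j _ => by ring
  have key : ∀ α : Fin (n + 1) → ℝ, ∑ j, α j = 1 → ∑ j, α j • p j ∈ K →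
      ∀ k, -(2 * (η + 2 * τ)) ≤ α k := fun α hα hx k =>
    coeff_ge_of_nearly_identity (b := fun j k => w k * (1 - ⟪p j, g k⟫)) hη hτ hw hw1
      (fun j => hrow (p j)) hdiag (fun j k => hlow _ (hp j) k) hsmall hα
      (fun k => by rw [hcomb, hα]; exact hlow _ hx k) k
  refine ⟨affineIndependent_iff.2 fun s v hv hvp j hj => ?_, key⟩
  -- a dependency could be added to the coordinates of `p 0` with any factor
  let v' : Fin (n + 1) → ℝ := fun j => if j ∈ s then v j else 0
  have hv' : ∑ j, v' j = 0 := by simpa [v'] using hv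
  have hvp' : ∑ j, v' j • p j = 0 := by simpa [v', ite_smul] using hvp
  have hall : ∀ T : ℝ, -(2 * (η + 2 * τ)) ≤ (Pi.single 0 1 : Fin (n + 1) → ℝ) j + T * v' j := by
    intro T
    refine key (fun j => (Pi.single 0 1 : Fin (n + 1) → ℝ) j + T * v' j) ?_ ?_ j
    · rw [Finset.sum_add_distrib, ← Finset.mul_sum, hv']; simp
    · simp only [add_smul, Finset.sum_add_distrib, mul_smul, ← Finset.smul_sum, hvp']
      simpa [Pi.single_apply, ite_smul] using hp 0
  have hvj : v' j = v j := by simp [v', hj]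
  by_contra hne
  rw [← hvj] at hne
  have h := hall ((-(2 * (η + 2 * τ)) - 1 - (Pi.single 0 1 : Fin (n + 1) → ℝ) j) / v' j)
  rw [div_mul_cancel₀ _ hne] at h
  linarith

section

variable [FiniteDimensional ℝ E]

/-- If all points of `K` have barycentric coordinates at least `-s` with respect to points `p j` of
`K`, then `K` lies between the simplex with vertices `p j` and its homothetic copy of ratio
`1 + (n + 1) s` about the barycenter; all simplices are affinely equivalent. -/
theorem sandwich_simplex_of_coeff_ge {n : ℕ} (hn : Module.finrank ℝ E = n) {K : Set E}
    (hK : Convex ℝ K) {p q : Fin (n + 1) → E} (hp : AffineIndependent ℝ p)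
    (hq : AffineIndependent ℝ q) (hpK : ∀ j, p j ∈ K) {s : ℝ} (hs : 0 ≤ s)
    (hcoef : ∀ α : Fin (n + 1) → ℝ, ∑ j, α j = 1 → ∑ j, α j • p j ∈ K → ∀ k, -s ≤ α k) :
    Sandwich K (convexHull ℝ (range q)) (1 + (n + 1) * s) := by
  have hcard : Fintype.card (Fin (n + 1)) = Module.finrank ℝ E + 1 := by simp [hn]
  let bp : AffineBasis (Fin (n + 1)) ℝ E :=
    ⟨p, hp, (hp.affineSpan_eq_top_iff_card_eq_finrank_add_one).2 hcard⟩
  let bq : AffineBasis (Fin (n + 1)) ℝ E :=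
    ⟨q, hq, (hq.affineSpan_eq_top_iff_card_eq_finrank_add_one).2 hcard⟩
  let T : E ≃ₗ[ℝ] E := (bq.basisOf 0).equiv (bp.basisOf 0) (Equiv.refl _)
  have hT0 : ∀ j, T (q j - q 0) = p j - p 0 := by
    intro j
    by_cases hj : j = 0
    · simp [hj]
    · have h1 : q j - q 0 = bq.basisOf 0 ⟨j, hj⟩ := (bq.basisOf_apply 0 ⟨j, hj⟩).symm
      have h2 : p j - p 0 = bp.basisOf 0 ⟨j, hj⟩ := (bp.basisOf_apply 0 ⟨j, hj⟩).symm
      rw [h1, h2]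
      exact (bq.basisOf 0).equiv_apply _ _ _
  have hT : ∀ δ : Fin (n + 1) → ℝ, ∑ j, δ j = 0 → T (∑ j, δ j • q j) = ∑ j, δ j • p j := by
    intro δ hδ
    have hshift : ∀ r : Fin (n + 1) → E, ∑ j, δ j • (r j - r 0) = ∑ j, δ j • r j := fun r => by
      simp only [smul_sub, Finset.sum_sub_distrib, ← Finset.sum_smul, hδ, zero_smul, sub_zero]
    rw [← hshift q, ← hshift p, map_sum]
    exact Finset.sum_congr rfl fun j _ => by rw [map_smul, hT0]
  set ρ : ℝ := 1 + (n + 1) * s with hρ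
  have hN : (0 : ℝ) < n + 1 := by positivity
  have hρpos : 0 < ρ := by positivity
  set e : ℝ := ((n : ℝ) + 1)⁻¹ with he
  have hsume : ∑ _j : Fin (n + 1), e = 1 := by
    rw [Finset.sum_const, Finset.card_univ, Fintype.card_fin, nsmul_eq_mul]
    push_cast; exact mul_inv_cancel₀ hN.ne'
  have hTρ : ∀ (γ : Fin (n + 1) → ℝ), ∑ j, γ j = 1 →
      ρ • T (-(∑ j, e • q j) + ∑ j, γ j • q j) = ρ • (-(∑ j, e • p j) + ∑ j, γ j • p j) := by
    intro γ hγ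
    have hshift : ∀ r : Fin (n + 1) → E,
        -(∑ j, e • r j) + ∑ j, γ j • r j = ∑ j, (γ j - e) • r j := fun r => by
      simp only [sub_smul, Finset.sum_sub_distrib]; abel
    rw [hshift, hshift, hT _ (by rw [Finset.sum_sub_distrib, hγ, hsume, sub_self])]
  rw [sandwich_iff]
  refine ⟨T.trans (LinearEquiv.smulOfNeZero ℝ E ρ hρpos.ne'), -∑ j, e • p j, -∑ j, e • q j,
    fun x hx => ?_, fun y hy => ?_⟩
  · obtain ⟨α, hα, rfl⟩ : ∃ α : Fin (n + 1) → ℝ, ∑ j, α j = 1 ∧ ∑ j, α j • p j = x :=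
      ⟨fun j => bp.coord j x, bp.sum_coord_apply_eq_one x, bp.linear_combination_coord_eq_self x⟩
    let γ : Fin (n + 1) → ℝ := fun j => (α j - e) / ρ + e
    have hγ : ∑ j, γ j = 1 := by
      simp only [γ, Finset.sum_add_distrib, ← Finset.sum_div, Finset.sum_sub_distrib, hα, hsume]
      simp
    have hγ0 : ∀ j, 0 ≤ γ j := fun j => by
      have h1 := hcoef α hα hx j
      have h2 : e * ρ = e + s := by rw [hρ, he]; field_simp
      have h3 : γ j = (α j - e + e * ρ) / ρ := by simp only [γ]; field_simp
      rw [h3, h2]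
      exact div_nonneg (by linarith) hρpos.le
    refine ⟨∑ j, γ j • q j, ?_, ?_⟩
    · exact mem_convexHull_of_exists_fintype γ q hγ0 hγ (fun j => mem_range_self j) rfl
    · change ρ • T _ = _
      rw [hTρ γ hγ, ← Finset.sum_neg_distrib, ← Finset.sum_add_distrib,
        ← Finset.sum_add_distrib, Finset.smul_sum]
      refine Finset.sum_congr rfl fun j _ => ?_
      simp only [γ]
      match_scalars
      field_simp
      ring
  · have hy' : y ∈ convexHull ℝ (range bq) := hy
    rw [bq.convexHull_eq_nonneg_coord] at hy'
    have hγ := bq.sum_coord_apply_eq_one y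
    refine ⟨∑ j, bq.coord j y • p j, hK.sum_mem (fun j _ => hy' j) hγ fun j _ => hpK j, ?_⟩
    have hyq : ∑ j, bq.coord j y • q j = y := bq.linear_combination_coord_eq_self y
    have h := hTρ (fun j => bq.coord j y) hγ
    rw [hyq] at h
    exact h

end

/-! ### Stability -/

/-- If the diagonal of a matrix `b` of row sums `1` and nearly nonnegative entries has sum at least
`n + 1 - σ`, then no diagonal entry is much less than `1`. -/
theorem diag_ge_of_trace_ge {n : ℕ} {b : Fin (n + 1) → Fin (n + 1) → ℝ} {v : Fin (n + 1) → ℝ}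
    {σ τ : ℝ} (hv : ∀ k, 0 ≤ v k) (hvτ : ∑ k, v k ≤ τ) (hrow : ∀ j, ∑ k, b j k = 1)
    (hlow : ∀ j k, -v k ≤ b j k) (htr : n + 1 - σ ≤ ∑ j, b j j) (j : Fin (n + 1)) :
    1 - (σ + n * τ) ≤ b j j := by
  have hle : ∀ j, b j j ≤ 1 + τ := fun j => by
    have h1 : b j j + ∑ k ∈ Finset.univ.erase j, b j k = ∑ k, b j k :=
      Finset.add_sum_erase _ _ (Finset.mem_univ _)
    have h2 : ∑ k ∈ Finset.univ.erase j, -v k ≤ ∑ k ∈ Finset.univ.erase j, b j k :=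
      Finset.sum_le_sum fun k _ => hlow j k
    have h3 : ∑ k ∈ Finset.univ.erase j, v k ≤ ∑ k, v k :=
      Finset.sum_le_sum_of_subset_of_nonneg (Finset.subset_univ _) fun k _ _ => hv k
    rw [Finset.sum_neg_distrib] at h2
    linarith [hrow j]
  have h1 : b j j + ∑ k ∈ Finset.univ.erase j, b k k = ∑ k, b k k :=
    Finset.add_sum_erase _ (fun k => b k k) (Finset.mem_univ _)
  have h2 : ∑ k ∈ Finset.univ.erase j, b k k ≤ ∑ k ∈ Finset.univ.erase j, (1 + τ) :=
    Finset.sum_le_sum fun k _ => hle k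
  rw [Finset.sum_const, Finset.card_erase_of_mem (Finset.mem_univ j), Finset.card_univ,
    Fintype.card_fin, Nat.add_sub_cancel, nsmul_eq_mul] at h2
  linarith

section

variable [FiniteDimensional ℝ E]

/-- Stability for a pair in John position. With `D = n (1 + a)`, the hypothesis `hstab` says that a
functional of `L°` almost norming a contact point is within `t` of the contact normal. If no
translate of `-(1 - ε) n L` contains `K`, then `K` is close to a simplex. -/
theorem sandwich_simplex_of_johnDecomposition {n : ℕ} (hn2 : 2 ≤ n)
    (hn : Module.finrank ℝ E = n) {K L : Set E} {ι : Type} [Fintype ι]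
    (J : JohnDecomposition K L ι) (hK : Convex ℝ K) (hL : IsBody L) (h0 : (0 : E) ∈ interior L)
    (hLK : L ⊆ K) {a : ℝ} (ha : 0 ≤ a) (hneg : ∀ x ∈ L, ∃ y ∈ L, -x = a • y)
    {D ε t r : ℝ} (hD : D = n * (1 + a)) (hε : 0 ≤ ε) (ht : 0 ≤ t)
    (hstab : ∀ l ∈ L, ∀ f ∈ polarBody L, ∀ g ∈ polarBody L, ⟪l, f⟫ = 1 →
      1 - ⟪l, g⟫ ≤ 4 * n ^ 2 * D * ε → ∀ x ∈ L, ⟪x, g - f⟫ ≤ t)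
    (hr : r ≤ 1 / (20 * n ^ 3)) (hη : ε * n + n * (D * t) ≤ n ^ 2 * r)
    (hno : ∀ y : E, ∃ x ∈ K, ∀ l ∈ L, x ≠ y - ((1 - ε) * n) • l)
    {q : Fin (n + 1) → E} (hq : AffineIndependent ℝ q) :
    Sandwich K (convexHull ℝ (range q)) (1 + (n + 1) * (4 * (n ^ 2 * r))) := by
  obtain ⟨p, g, w, hp, hg, hw, hw1, hg0, hlt⟩ := exists_certificate hL h0 hno hn
  have hn2' : (2 : ℝ) ≤ n := by exact_mod_cast hn2
  have hnpos : (0 : ℝ) < n := by linarith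
  have hD1 : 1 ≤ D := by rw [hD]; nlinarith
  have hDt : 0 ≤ D * t := by positivity
  set η := ε * n + n * (D * t) with hηdef
  have hη0 : 0 ≤ η := by positivity
  have hη1 : η ≤ 1 / (20 * (n : ℝ)) := by
    refine hη.trans ?_
    calc (n : ℝ) ^ 2 * r ≤ (n : ℝ) ^ 2 * (1 / (20 * (n : ℝ) ^ 3)) := by gcongr
      _ = 1 / (20 * (n : ℝ)) := by field_simp
  have hη2 : n * η ≤ 1 / 20 := by
    rw [le_div_iff₀ (by positivity)] at hη1 ⊢
    linarith
  have hKD : ∀ {h : E} {s : ℝ}, (∀ l ∈ L, ⟪l, h⟫ ≤ s) → ∀ y ∈ K, |⟪y, h⟫| ≤ D * s := by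
    intro h s hs y hy
    have := J.abs_inner_le ha hneg hs hy
    rwa [hn, ← hD] at this
  have hgL : ∀ k, ∀ l ∈ L, ⟪l, g k⟫ ≤ 1 := fun k l hl => by
    rw [real_inner_comm]; exact hg k l hl
  have hgK : ∀ k, ∀ y ∈ K, |⟪y, g k⟫| ≤ D := fun k y hy => by
    simpa using hKD (hgL k) y hy
  -- a normal `g k` of substantial weight is close to a contact normal
  have hclose : ∀ k, 1 / (4 * n ^ 2 * D) ≤ w k → ∀ y ∈ K, ⟪y, g k⟫ ≤ 1 + D * t := by
    intro k hk y hy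
    have hwk : 0 < w k := lt_of_lt_of_le (by positivity) hk
    have hterm : ∀ j i, 0 ≤ J.c i * (1 - ⟪p j, J.f i⟫) * (1 - ⟪J.x i, g j⟫) := fun j i =>
      mul_nonneg (mul_nonneg (J.c_nonneg i) (J.one_sub_nonneg (hp j) i))
        (sub_nonneg.2 (hgL j _ (J.x_mem i)))
    have hdef : w k * ∑ i, J.c i * (1 - ⟪p k, J.f i⟫) * (1 - ⟪J.x i, g k⟫) ≤ ε * n := by
      calc w k * ∑ i, J.c i * (1 - ⟪p k, J.f i⟫) * (1 - ⟪J.x i, g k⟫)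
          ≤ ∑ j, w j * ∑ i, J.c i * (1 - ⟪p j, J.f i⟫) * (1 - ⟪J.x i, g j⟫) :=
            Finset.single_le_sum (f := fun j =>
              w j * ∑ i, J.c i * (1 - ⟪p j, J.f i⟫) * (1 - ⟪J.x i, g j⟫))
              (fun j _ => mul_nonneg (hw j) (Finset.sum_nonneg fun i _ => hterm j i))
              (Finset.mem_univ k)
        _ = n + ∑ j, w j * ⟪p j, g j⟫ := by rw [J.sum_sum_mul_one_sub hw1 hg0, hn]
        _ ≤ ε * n := by
          simp only [mul_neg, Finset.sum_neg_distrib] at hlt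
          linarith
    -- the weights `c i (1 - ⟪p k, f i⟫)` have mass `n`, so some defect is at most `ε / w k`
    obtain ⟨i, hi⟩ : ∃ i, w k * (1 - ⟪J.x i, g k⟫) ≤ ε := by
      by_contra! hcon
      have hW := J.sum_weights (p k)
      rw [hn] at hW
      have h1 : ∑ i, J.c i * (1 - ⟪p k, J.f i⟫) * ε <
          ∑ i, J.c i * (1 - ⟪p k, J.f i⟫) * (w k * (1 - ⟪J.x i, g k⟫)) := by
        have hWi : ∀ i, 0 ≤ J.c i * (1 - ⟪p k, J.f i⟫) := fun i =>
          mul_nonneg (J.c_nonneg i) (J.one_sub_nonneg (hp k) i)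
        refine Finset.sum_lt_sum (fun i _ => mul_le_mul_of_nonneg_left (hcon i).le (hWi i)) ?_
        by_contra! hz
        have : ∀ i, J.c i * (1 - ⟪p k, J.f i⟫) = 0 := fun i => by
          by_contra hne
          exact absurd (mul_lt_mul_of_pos_left (hcon i) (lt_of_le_of_ne (hWi i) (Ne.symm hne)))
            (not_lt.2 (hz i (Finset.mem_univ i)))
        simp only [this, Finset.sum_const_zero] at hW
        linarith
      rw [← Finset.sum_mul, hW] at h1
      rw [Finset.mul_sum] at hdef
      have h2 : ∑ i, J.c i * (1 - ⟪p k, J.f i⟫) * (w k * (1 - ⟪J.x i, g k⟫)) =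
          ∑ i, w k * (J.c i * (1 - ⟪p k, J.f i⟫) * (1 - ⟪J.x i, g k⟫)) :=
        Finset.sum_congr rfl fun i _ => by ring
      linarith
    have hdefect : 1 - ⟪J.x i, g k⟫ ≤ 4 * n ^ 2 * D * ε := by
      have h1 : 0 ≤ 1 - ⟪J.x i, g k⟫ := sub_nonneg.2 (hgL k _ (J.x_mem i))
      have h2 : 1 / (4 * n ^ 2 * D) * (1 - ⟪J.x i, g k⟫) ≤ ε :=
        (mul_le_mul_of_nonneg_right hk h1).trans hi
      rw [one_div, inv_mul_le_iff₀ (by positivity)] at h2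
      exact h2
    have h1 := hstab _ (J.x_mem i) _ (polarBody_anti hLK (J.f_mem i)) _ (hg k) (J.inner_eq_one i)
      hdefect
    have h2 := (abs_le.1 (hKD h1 y hy)).2
    have h3 := J.one_sub_nonneg hy i
    rw [inner_sub_right] at h2
    linarith
  -- `b j k` are the barycentric coordinates of `p j` in the simplex cut out by the `g k`
  let b : Fin (n + 1) → Fin (n + 1) → ℝ := fun j k => w k * (1 - ⟪p j, g k⟫)
  have hrow : ∀ j, ∑ k, b j k = 1 := fun j => by
    have h := congrArg (fun z => ⟪p j, z⟫) hg0
    simp only [inner_sum, real_inner_smul_right, inner_zero_right] at h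
    simp only [b, mul_sub, mul_one, Finset.sum_sub_distrib, hw1, h, sub_zero]
  have htr : n + 1 - ε * n ≤ ∑ j, b j j := by
    simp only [b, mul_sub, mul_one, Finset.sum_sub_distrib, hw1]
    simp only [mul_neg, Finset.sum_neg_distrib] at hlt
    linarith
  -- a normal `g k` of small weight would make the trace of `b` too small: `b k k ≤ w k (1 + D)`,
  -- while the other diagonal entries exceed `1` by little
  have hwlow : ∀ k, 1 / (4 * n ^ 2 * D) ≤ w k := by
    intro k
    by_contra! hk
    set c : ℝ := 1 / (4 * n ^ 2 * D) with hc
    have hc0 : 0 ≤ c := by positivity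
    have hbound : ∀ x ∈ K, ∀ m, -(D * t * w m + c * (D - 1)) ≤ w m * (1 - ⟪x, g m⟫) := by
      intro x hx m
      rcases le_or_gt c (w m) with h | h
      · have h1 := mul_le_mul_of_nonneg_left (hclose m h x hx) (hw m)
        have h2 : 0 ≤ c * (D - 1) := mul_nonneg hc0 (by linarith)
        linarith
      · have h1 := mul_le_mul_of_nonneg_left (abs_le.1 (hgK m x hx)).2 (hw m)
        have h2 : w m * (D - 1) ≤ c * (D - 1) := mul_le_mul_of_nonneg_right h.le (by linarith)
        have h3 : 0 ≤ D * t * w m := mul_nonneg hDt (hw m)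
        linarith
    have hdiagk := diag_ge_of_trace_ge (τ := D * t + (n + 1) * (c * (D - 1)))
      (v := fun m => D * t * w m + c * (D - 1))
      (fun m => add_nonneg (mul_nonneg hDt (hw m)) (mul_nonneg hc0 (by linarith)))
      (by
        rw [Finset.sum_add_distrib, ← Finset.mul_sum, hw1, Finset.sum_const, Finset.card_univ,
          Fintype.card_fin, nsmul_eq_mul]
        push_cast; linarith) hrow (fun j m => hbound _ (hp j) m) htr k
    have hbk : b k k ≤ c * (1 + D) := by
      have h1 := (abs_le.1 (hgK k _ (hp k))).1
      exact (mul_le_mul_of_nonneg_left (by linarith) (hw k)).trans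
        (mul_le_mul_of_nonneg_right hk.le (by linarith))
    have hcD : c * D * (4 * n ^ 2) = 1 := by rw [hc]; field_simp
    have hcc : c ≤ c * D := le_mul_of_one_le_right hc0 hD1
    have h4 : c * D * 16 ≤ 1 := by
      rw [← hcD]
      exact mul_le_mul_of_nonneg_left (by nlinarith) (by positivity)
    have h5 : n * ((n + 1) * (c * (D - 1))) ≤ 3 / 8 := by
      have h6 : n * ((n + 1) * (c * (D - 1))) ≤ (c * D) * (n * (n + 1)) := by
        have : 0 ≤ n * (n + 1) * c := by positivity
        linarith
      have h7 : (c * D) * (n * (n + 1)) ≤ (c * D) * (3 / 2 * n ^ 2) :=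
        mul_le_mul_of_nonneg_left (by nlinarith) (by positivity)
      linarith
    have h8 : η ≤ 1 / 40 := by nlinarith
    linarith
  have hlow : ∀ x ∈ K, ∀ k, -(D * t * w k) ≤ w k * (1 - ⟪x, g k⟫) := fun x hx k => by
    have := mul_le_mul_of_nonneg_left (hclose k (hwlow k) x hx) (hw k)
    linarith
  have hdiag := diag_ge_of_trace_ge (τ := D * t) (fun k => mul_nonneg hDt (hw k))
    (by rw [← Finset.mul_sum, hw1, mul_one]) hrow (fun j k => hlow _ (hp j) k) htr
  have hτη : 2 * (D * t) ≤ η := by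
    have : 2 * (D * t) ≤ n * (D * t) := mul_le_mul_of_nonneg_right hn2' hDt
    have : 0 ≤ ε * n := by positivity
    linarith
  obtain ⟨hind, hcoef⟩ := affineIndependent_and_coeff_ge hη0 hDt hw hw1 hg0 hp hdiag hlow (by
    nlinarith)
  refine sandwich_simplex_of_coeff_ge hn hK hind hq hp (by nlinarith) fun α hα hx k => ?_
  have := hcoef α hα hx k
  linarith

end

theorem isBody_affine_image [FiniteDimensional ℝ E] {K L : Set E} (hK : IsBody K) (hL : IsBody L)
    {T : E ≃ₗ[ℝ] E} {a : E} (hLK : L ⊆ a +ᵥ (T '' K)) : IsBody (a +ᵥ (T '' K)) where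
  convex := (hK.convex.linear_image (T : E →ₗ[ℝ] E)).vadd a
  compact := (hK.compact.image (LinearMap.continuous_of_finiteDimensional
    (T : E →ₗ[ℝ] E))).vadd a
  interior_nonempty := hL.interior_nonempty.mono (interior_mono hLK)

/-- Stability under an abstract quantitative strict convexity `hstab` of the polar body of `L`. -/
theorem distBM_le_of_stable [FiniteDimensional ℝ E] {n : ℕ} (hn2 : 2 ≤ n)
    (hn : Module.finrank ℝ E = n) {K L S : Set E} (hK : IsBody K) (hL : IsBody L)
    (h0 : (0 : E) ∈ interior L) (hS : IsRegularSimplex n S)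
    {a : ℝ} (ha : 0 ≤ a) (hneg : ∀ x ∈ L, ∃ y ∈ L, -x = a • y)
    {D ε ε' t r : ℝ} (hD : D = n * (1 + a)) (hε : 0 ≤ ε) (hεε' : ε < ε') (ht : 0 ≤ t)
    (hstab : ∀ l ∈ L, ∀ f ∈ polarBody L, ∀ g ∈ polarBody L, ⟪l, f⟫ = 1 →
      1 - ⟪l, g⟫ ≤ 4 * n ^ 2 * D * ε' → ∀ x ∈ L, ⟪x, g - f⟫ ≤ t)
    (hr0 : 0 ≤ r) (hr : r ≤ 1 / (20 * n ^ 3)) (hη : ε' * n + n * (D * t) ≤ n ^ 2 * r)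
    (hdist : (1 - ε) * n ≤ distG K L) : distBM K S ≤ 1 + 40 * n ^ 3 * r := by
  have hn2' : (2 : ℝ) ≤ n := by exact_mod_cast hn2
  have hnpos : (0 : ℝ) < n := by linarith
  have hD0 : 0 ≤ D := by rw [hD]; positivity
  obtain ⟨T, b, hLK, hmax⟩ := exists_maximal_volume_position hK hL h0
  have hK' := isBody_affine_image hK hL hLK
  obtain ⟨ι, _, ⟨J⟩⟩ := exists_johnDecomposition hK' hL h0 hLK (by omega) hmax
  rw [← distG_affine_image_left K L T b] at hdist
  rw [← distBM_affine_image_left K S T b]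
  obtain ⟨s, -, rfl⟩ := hS
  have hε1 : 0 < (1 - ε') * n := by
    have h1 : ε' * n ≤ n ^ 2 * r := by
      have : 0 ≤ n * (D * t) := by positivity
      linarith
    have h2 : (n : ℝ) ^ 2 * r ≤ n ^ 2 * (1 / (20 * n ^ 3)) := by gcongr
    have h3 : (n : ℝ) ^ 2 * (1 / (20 * n ^ 3)) = 1 / (20 * n) := by field_simp
    have h4 : 1 / (20 * (n : ℝ)) ≤ 1 := by
      rw [div_le_one (by positivity)]; linarith
    linarith
  have hsand := sandwich_simplex_of_johnDecomposition hn2 hn J hK'.convex hL h0 hLK ha hneg hD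
    (hε.trans hεε'.le) ht hstab hr hη (fun y => by
      by_contra! hcon
      have h1 := distG_le_of_subset hε1 hLK y hcon
      have h2 : (1 - ε') * n < (1 - ε) * n := mul_lt_mul_of_pos_right (by linarith) hnpos
      linarith) s.independent
  refine (distBM_le (by positivity) hsand).trans ?_
  have h1 : 0 ≤ (n : ℝ) ^ 2 * r := by positivity
  nlinarith [mul_le_mul_of_nonneg_left hn2' h1, mul_nonneg h1 hnpos.le]

/-! ### The modulus of convexity of the polar body -/

theorem inner_le_gauge_polarBody {L : Set E} (hL : Bornology.IsBounded L) {l : E} (hl : l ∈ L)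
    (m : E) : ⟪l, m⟫ ≤ gauge (polarBody L) m := by
  refine le_of_forall_gt_imp_ge_of_dense fun c hc => ?_
  obtain ⟨s, hs, hsc, z, hz, rfl⟩ := exists_lt_of_gauge_lt
    (absorbent_nhds_zero (𝕜 := ℝ) (polarBody_mem_nhds hL)) hc
  have h := hz l hl
  rw [real_inner_comm] at h
  simp only [real_inner_smul_right]
  nlinarith

theorem gauge_polarBody_midpoint_le_one {L : Set E} {x y : E} (hx : x ∈ polarBody L)
    (hy : y ∈ polarBody L) : gauge (polarBody L) ((1 / 2 : ℝ) • (x + y)) ≤ 1 := by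
  refine gauge_le_one_of_mem ?_
  rw [smul_add]
  exact convex_polarBody L hx hy (by norm_num) (by norm_num) (by norm_num)

theorem modulusOfConvexity_le {L : Set E} {t : ℝ} {x y : E} (hx : x ∈ polarBody L)
    (hy : y ∈ polarBody L) (h : t ≤ gauge (polarBody L) (x - y)) :
    modulusOfConvexity (polarBody L) t ≤ 1 - gauge (polarBody L) ((1 / 2 : ℝ) • (x + y)) := by
  refine csInf_le ⟨0, ?_⟩ ⟨x, hx, y, hy, h, rfl⟩
  rintro _ ⟨x, hx, y, hy, -, rfl⟩
  linarith [gauge_polarBody_midpoint_le_one hx hy]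

/-- If `f` norms the point `l` of `L` and `g` almost norms it, then the midpoint of `f` and `g` has
gauge close to `1`, so `g` is close to `f`. -/
theorem inner_sub_le_of_modulus {L : Set E} (hL : Bornology.IsBounded L) {l f g : E} {t : ℝ}
    (hl : l ∈ L) (hf : f ∈ polarBody L) (hg : g ∈ polarBody L) (hlf : ⟪l, f⟫ = 1)
    (hlg : 1 - ⟪l, g⟫ < 2 * modulusOfConvexity (polarBody L) t) {x : E} (hx : x ∈ L) :
    ⟪x, g - f⟫ ≤ t := by
  refine (inner_le_gauge_polarBody hL hx _).trans ?_
  by_contra! hlt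
  have h1 := modulusOfConvexity_le hg hf hlt.le
  have h2 := inner_le_gauge_polarBody hL hl ((1 / 2 : ℝ) • (g + f))
  rw [real_inner_smul_right, inner_add_right, hlf] at h2
  linarith

theorem exists_mem_polarBody_gauge_eq_one [Nontrivial E] {L : Set E} (hL : IsBody L)
    (h0 : (0 : E) ∈ interior L) : ∃ x ∈ polarBody L, gauge (polarBody L) x = 1 := by
  have hnhds := polarBody_mem_nhds hL.compact.isBounded
  obtain ⟨v, hv⟩ := exists_ne (0 : E)
  have hpos : 0 < gauge (polarBody L) v :=
    (gauge_pos (absorbent_nhds_zero hnhds)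
      (NormedSpace.isVonNBounded_of_isBounded ℝ (isBounded_polarBody h0))).2 hv
  have hone : gauge (polarBody L) ((gauge (polarBody L) v)⁻¹ • v) = 1 := by
    rw [gauge_smul_of_nonneg (inv_nonneg.2 hpos.le), smul_eq_mul, inv_mul_cancel₀ hpos.ne']
  refine ⟨_, ?_, hone⟩
  have := (gauge_le_one_iff_mem_closure (convex_polarBody L) hnhds).1 hone.le
  rwa [(isClosed_polarBody L).closure_eq] at this

theorem modulusOfConvexity_le_one [Nontrivial E] {L : Set E} (hL : IsBody L)
    (h0 : (0 : E) ∈ interior L) {t : ℝ} (ht : t ≤ 1) :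
    modulusOfConvexity (polarBody L) t ≤ 1 := by
  obtain ⟨x, hx, hx1⟩ := exists_mem_polarBody_gauge_eq_one hL h0
  refine (modulusOfConvexity_le hx (zero_mem_polarBody L) (by rwa [sub_zero, hx1])).trans ?_
  linarith [gauge_nonneg (s := polarBody L) ((1 / 2 : ℝ) • (x + 0))]

/-- The polar body of a smooth body is strictly convex: if the midpoint of `x` and `y` is on its
boundary, then both `x` and `y` define a supporting hyperplane of `L` at the same point. -/
theorem gauge_polarBody_midpoint_lt_one {L : Set E} (hL : IsBody L) (hsm : IsSmoothBody L)
    (h0 : (0 : E) ∈ interior L) {x y : E} (hx : x ∈ polarBody L) (hy : y ∈ polarBody L)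
    (hxy : x ≠ y) : gauge (polarBody L) ((1 / 2 : ℝ) • (x + y)) < 1 := by
  have h0L : (0 : E) ∈ L := interior_subset h0
  obtain ⟨l, hl, hmax⟩ := hL.compact.exists_isMaxOn ⟨0, h0L⟩
    (f := fun l => ⟪l, (1 / 2 : ℝ) • (x + y)⟫) (by fun_prop)
  by_contra! hge
  have hl1 : 1 ≤ ⟪l, (1 / 2 : ℝ) • (x + y)⟫ := by
    by_contra! hlt
    set c := max ⟪l, (1 / 2 : ℝ) • (x + y)⟫ (1 / 2) with hc
    have hc0 : 0 < c := lt_of_lt_of_le (by norm_num) (le_max_right _ _)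
    have hc1 : c < 1 := max_lt hlt (by norm_num)
    have hmem : (1 / 2 : ℝ) • (x + y) ∈ c • polarBody L := by
      rw [mem_smul_set_iff_inv_smul_mem₀ hc0.ne']
      intro z hz
      rw [real_inner_smul_left, inv_mul_le_iff₀ hc0, mul_one, real_inner_comm]
      exact (hmax hz).trans (le_max_left _ _)
    exact absurd (gauge_le_of_mem hc0.le hmem) (not_le.2 (hc1.trans_le hge))
  have hx1 := hx l hl
  have hy1 := hy l hl
  rw [real_inner_comm] at hx1 hy1
  rw [real_inner_smul_right, inner_add_right] at hl1
  have hlx : ⟪l, x⟫ = 1 := by linarith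
  have hly : ⟪l, y⟫ = 1 := by linarith
  have hne : ∀ z : E, ⟪l, z⟫ = 1 → z ≠ 0 := by
    rintro z hz rfl
    simp at hz
  have hfr : l ∈ frontier L := by
    rw [hL.compact.isClosed.frontier_eq]
    refine ⟨hl, fun hint => ?_⟩
    have hnorm : 0 < ‖x‖ := norm_pos_iff.2 (hne x hlx)
    obtain ⟨ρ, hρ, hball⟩ := Metric.isOpen_iff.1 isOpen_interior l hint
    have h1 := hx (l + (ρ / 2 / ‖x‖) • x) (interior_subset (hball (by
      rw [Metric.mem_ball, dist_self_add_left, norm_smul, Real.norm_of_nonneg (by positivity),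
        div_mul_cancel₀ _ hnorm.ne']
      linarith)))
    rw [real_inner_comm, inner_add_left, real_inner_smul_left, hlx,
      real_inner_self_eq_norm_sq] at h1
    have : 0 < ρ / 2 / ‖x‖ * ‖x‖ ^ 2 := by positivity
    linarith
  have hsupp : ∀ z ∈ polarBody L, ⟪l, z⟫ = 1 →
      IsSupportingHyperplane L l {w : E | ⟪w, z⟫ = ⟪l, z⟫} := fun z hz hlz =>
    ⟨z, hne z hlz, fun w hw => by rw [hlz, real_inner_comm]; exact hz w hw, rfl⟩
  have heq := (hsm l hfr).unique (hsupp x hx hlx) (hsupp y hy hly)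
  rw [hlx, hly] at heq
  -- the points of the two hyperplanes nearest to the origin
  have hscale : ∀ z : E, z ≠ 0 → ⟪(‖z‖ ^ 2)⁻¹ • z, z⟫ = 1 := fun z hz => by
    rw [real_inner_smul_left, real_inner_self_eq_norm_sq]
    exact inv_mul_cancel₀ (pow_ne_zero 2 (norm_ne_zero_iff.2 hz))
  have h1 : ⟪(‖x‖ ^ 2)⁻¹ • x, y⟫ = 1 := by
    have : (‖x‖ ^ 2)⁻¹ • x ∈ {w : E | ⟪w, x⟫ = 1} := hscale x (hne x hlx)
    rw [heq] at this
    exact this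
  have h2 : ⟪(‖y‖ ^ 2)⁻¹ • y, x⟫ = 1 := by
    have : (‖y‖ ^ 2)⁻¹ • y ∈ {w : E | ⟪w, y⟫ = 1} := hscale y (hne y hly)
    rw [← heq] at this
    exact this
  have hxn : 0 < ‖x‖ ^ 2 := pow_pos (norm_pos_iff.2 (hne x hlx)) 2
  have hyn : 0 < ‖y‖ ^ 2 := pow_pos (norm_pos_iff.2 (hne y hly)) 2
  rw [real_inner_smul_left, inv_mul_eq_one₀ hxn.ne'] at h1
  rw [real_inner_smul_left, inv_mul_eq_one₀ hyn.ne', real_inner_comm] at h2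
  have h3 : ‖x - y‖ ^ 2 = 0 := by
    rw [norm_sub_sq_real]; linarith
  exact hxy (sub_eq_zero.1 (norm_eq_zero.1 (pow_eq_zero_iff two_ne_zero |>.1 h3)))

section

variable [FiniteDimensional ℝ E]

theorem modulusOfConvexity_pos [Nontrivial E] {L : Set E} (hL : IsBody L) (hsm : IsSmoothBody L)
    (h0 : (0 : E) ∈ interior L) {t : ℝ} (ht0 : 0 < t) (ht : t ≤ 1) :
    0 < modulusOfConvexity (polarBody L) t := by
  have hgc : Continuous (gauge (polarBody L)) :=
    continuous_gauge (convex_polarBody L) (polarBody_mem_nhds hL.compact.isBounded)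
  have hMc := isCompact_polarBody h0
  have hP : IsCompact ((polarBody L ×ˢ polarBody L) ∩
      {p : E × E | t ≤ gauge (polarBody L) (p.1 - p.2)}) :=
    (hMc.prod hMc).inter_right (isClosed_le continuous_const (by fun_prop))
  obtain ⟨x0, hx0, hx1⟩ := exists_mem_polarBody_gauge_eq_one hL h0
  obtain ⟨⟨x, y⟩, ⟨⟨hx, hy⟩, hxy⟩, hmax⟩ := hP.exists_isMaxOn
    ⟨(x0, 0), ⟨hx0, zero_mem_polarBody L⟩, by simpa [hx1] using ht⟩
    (f := fun p : E × E => gauge (polarBody L) ((1 / 2 : ℝ) • (p.1 + p.2))) (by fun_prop)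
  have hne : x ≠ y := by
    rintro rfl
    simp only [mem_ofPred_eq, sub_self, gauge_zero] at hxy
    linarith
  refine lt_of_lt_of_le (sub_pos.2 (gauge_polarBody_midpoint_lt_one hL hsm h0 hx hy hne))
    (le_csInf ⟨_, x, hx, y, hy, hxy, rfl⟩ ?_)
  rintro _ ⟨x', hx', y', hy', hxy', rfl⟩
  have := hmax (show (x', y') ∈ _ from ⟨⟨hx', hy'⟩, hxy'⟩)
  simp only [mem_ofPred_eq] at this
  linarith

end

/-! ### Smooth bodies and ellipsoids -/

theorem le_one_of_forall_small {d C r₀ : ℝ} (hC : 0 < C) (hr₀ : 0 < r₀)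
    (h : ∀ r, 0 < r → r ≤ r₀ → d ≤ 1 + C * r) : d ≤ 1 := by
  by_contra! hd
  have hpos : 0 < (d - 1) / (2 * C) := div_pos (by linarith) (by positivity)
  have h1 := h (min r₀ ((d - 1) / (2 * C))) (lt_min hr₀ hpos) (min_le_left _ _)
  have h2 : C * min r₀ ((d - 1) / (2 * C)) ≤ C * ((d - 1) / (2 * C)) :=
    mul_le_mul_of_nonneg_left (min_le_right _ _) hC.le
  have h3 : C * ((d - 1) / (2 * C)) = (d - 1) / 2 := by field_simp
  linarith

theorem one_div_twenty_mul_pow_le {n : ℕ} (hn2 : 2 ≤ n) : 1 / (20 * (n : ℝ) ^ 3) ≤ 1 / 160 := by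
  have hn2' : (2 : ℝ) ≤ n := by exact_mod_cast hn2
  have : (2 : ℝ) ^ 3 ≤ (n : ℝ) ^ 3 := by gcongr
  exact one_div_le_one_div_of_le (by norm_num) (by linarith)

theorem norm_le_one_of_mem_polarBody_closedBall {f : E}
    (hf : f ∈ polarBody (Metric.closedBall (0 : E) 1)) : ‖f‖ ≤ 1 := by
  by_cases h : f = 0
  · simp [h]
  have hn : 0 < ‖f‖ := norm_pos_iff.2 h
  have h1 := hf (‖f‖⁻¹ • f) (by
    rw [mem_closedBall_zero_iff, norm_smul, norm_inv, norm_norm, inv_mul_cancel₀ hn.ne'])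
  rw [real_inner_smul_right, real_inner_self_eq_norm_sq, sq, inv_mul_cancel_left₀ hn.ne'] at h1
  exact h1

section

variable [FiniteDimensional ℝ E]

/-- Stability for a small parameter `r`, with the slack in `r ≤ 1 / (20 n³)` used to pass from `ε`
to a strictly larger `ε' = r δ(t) / (2 n)`. -/
theorem distBM_le_of_modulus {n : ℕ} (hn2 : 2 ≤ n) (hn : Module.finrank ℝ E = n) {K L S : Set E}
    (hK : IsBody K) (hL : IsBody L) (h0 : (0 : E) ∈ interior L) (hS : IsRegularSimplex n S)
    (hneg : ∀ x ∈ L, ∃ y ∈ L, -x = (n : ℝ) • y) {ε t r : ℝ} (hε : 0 ≤ ε) (hr0 : 0 < r)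
    (hr : r ≤ 1 / (20 * n ^ 3)) (ht0 : 0 < t) (ht : t ≤ r * (1 / (2 * n ^ 2)))
    (hδ : 0 < modulusOfConvexity (polarBody L) t)
    (hadm : 4 * n * ε ≤ r * modulusOfConvexity (polarBody L) t)
    (hdist : (1 - ε) * n ≤ distG K L) : distBM K S ≤ 1 + 40 * n ^ 3 * r := by
  have hn2' : (2 : ℝ) ≤ n := by exact_mod_cast hn2
  have hnpos : (0 : ℝ) < n := by linarith
  have : Nontrivial E := Module.nontrivial_of_finrank_pos (R := ℝ) (by omega)
  set δ := modulusOfConvexity (polarBody L) t with hδdef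
  have hr160 := hr.trans (one_div_twenty_mul_pow_le hn2)
  have ht1 : t ≤ 1 := by
    have : 1 / (2 * (n : ℝ) ^ 2) ≤ 1 := by
      rw [div_le_one (by positivity)]; nlinarith
    nlinarith
  have hδ1 : δ ≤ 1 := modulusOfConvexity_le_one hL h0 ht1
  have hrδ : 0 < r * δ := mul_pos hr0 hδ
  have hr3 : r * (20 * n ^ 3) ≤ 1 := by rwa [le_div_iff₀ (by positivity)] at hr
  have hn1 : (n : ℝ) * (1 + n) ≤ 3 / 2 * n ^ 2 := by nlinarith
  have htn : t * (2 * n ^ 2) ≤ r := by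
    rw [mul_one_div, le_div_iff₀ (by positivity)] at ht
    exact ht
  refine distBM_le_of_stable (ε' := r * δ / (2 * n)) hn2 hn hK hL h0 hS hnpos.le hneg rfl hε ?_
    ht0.le ?_ hr0.le hr ?_ hdist
  · rw [lt_div_iff₀ (by positivity)]
    have h1 : 0 ≤ n * ε := by positivity
    linarith
  · intro l hl f hf g hg hlf hlg x hx
    refine inner_sub_le_of_modulus hL.compact.isBounded hl hf hg hlf (hlg.trans_lt ?_) hx
    have h1 : 4 * (n : ℝ) ^ 2 * (n * (1 + n)) * (r * δ / (2 * n)) =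
        2 * n * (n * (1 + n)) * (r * δ) := by field_simp; ring
    have h2 : 2 * n * (n * (1 + n)) * (r * δ) ≤ 2 * n * (3 / 2 * n ^ 2) * (r * δ) := by gcongr
    have h3 := mul_le_mul_of_nonneg_right hr3 hδ.le
    rw [h1]
    linarith
  · have h1 : r * δ / (2 * n) * n = r * δ / 2 := by field_simp
    have h2 : r * δ ≤ r := mul_le_of_le_one_right hr0.le hδ1
    have h3 : n * (n * (1 + n) * t) ≤ n * (3 / 2 * n ^ 2 * t) := by gcongr
    have h4 := mul_le_mul_of_nonneg_left htn hnpos.le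
    rw [h1]
    nlinarith

/-- Stability for all admissible `r`: a value of `r` above `r₀ = 1 / (20 n³)` may be replaced by `r₀`,
and `r = 0` forces `ε = 0`, so that every small positive `r` is admissible. -/
theorem distBM_le_of_admissible {n : ℕ} (hn2 : 2 ≤ n) (hn : Module.finrank ℝ E = n) {K L S : Set E}
    (hK : IsBody K) (hL : IsBody L) (hsm : IsSmoothBody L) (h0 : (0 : E) ∈ interior L)
    (hS : IsRegularSimplex n S) (hneg : ∀ x ∈ L, ∃ y ∈ L, -x = (n : ℝ) • y)
    {A s ε r : ℝ} (hA : 4 * n ≤ A) (hs0 : 0 < s) (hs : s ≤ 1 / (2 * n ^ 2)) (hε : 0 ≤ ε)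
    (hadm₀ : A * ε ≤ 1 / (20 * n ^ 3) *
      modulusOfConvexity (polarBody L) (1 / (20 * n ^ 3) * s))
    (hr0 : 0 ≤ r) (hadm : A * ε ≤ r * modulusOfConvexity (polarBody L) (r * s))
    (hdist : (1 - ε) * n ≤ distG K L) : distBM K S ≤ 1 + 40 * n ^ 3 * r := by
  have hn2' : (2 : ℝ) ≤ n := by exact_mod_cast hn2
  have hnpos : (0 : ℝ) < n := by linarith
  have : Nontrivial E := Module.nontrivial_of_finrank_pos (R := ℝ) (by omega)
  have hr₀ : (0 : ℝ) < 1 / (20 * n ^ 3) := by positivity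
  have hs1 : s ≤ 1 := hs.trans (by rw [div_le_one (by positivity)]; nlinarith)
  have hδ : ∀ r : ℝ, 0 < r → r ≤ 1 / (20 * n ^ 3) →
      0 < modulusOfConvexity (polarBody L) (r * s) := fun r h1 h2 =>
    modulusOfConvexity_pos hL hsm h0 (by positivity)
      (by nlinarith [one_div_twenty_mul_pow_le hn2])
  have hmain : ∀ r : ℝ, 0 < r → r ≤ 1 / (20 * n ^ 3) →
      A * ε ≤ r * modulusOfConvexity (polarBody L) (r * s) →
      distBM K S ≤ 1 + 40 * n ^ 3 * r := fun r h1 h2 h3 =>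
    distBM_le_of_modulus hn2 hn hK hL h0 hS hneg hε h1 h2 (by positivity)
      (mul_le_mul_of_nonneg_left hs h1.le) (hδ r h1 h2)
      ((mul_le_mul_of_nonneg_right hA hε).trans h3) hdist
  rcases hr0.eq_or_lt with rfl | hr0
  · have hε0 : ε = 0 := by
      rw [zero_mul] at hadm
      have : 0 < A := by linarith
      nlinarith
    rw [mul_zero, add_zero]
    refine le_one_of_forall_small (by positivity : (0 : ℝ) < 40 * n ^ 3) hr₀
      fun r h1 h2 => hmain r h1 h2 ?_
    rw [hε0, mul_zero]
    exact (mul_pos h1 (hδ r h1 h2)).le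
  rcases le_total r (1 / (20 * n ^ 3)) with h | h
  · exact hmain r hr0 h hadm
  · refine (hmain _ hr₀ le_rfl hadm₀).trans ?_
    gcongr

/-- The Euclidean ball is symmetric about the origin and its polar body is itself, so that the
defect controls the square of the distance of the normals. -/
theorem distBM_le_of_closedBall {n : ℕ} (hn2 : 2 ≤ n) (hn : Module.finrank ℝ E = n) {K S : Set E}
    (hK : IsBody K) (hS : IsRegularSimplex n S) {ε r : ℝ} (hε : 0 ≤ ε) (hr0 : 0 < r)
    (hr : r ≤ 1 / (20 * n ^ 3)) (hadm : 16 * ε ≤ r ^ 3)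
    (hdist : (1 - ε) * n ≤ distG K (Metric.closedBall (0 : E) 1)) :
    distBM K S ≤ 1 + 40 * n ^ 3 * r := by
  have hn2' : (2 : ℝ) ≤ n := by exact_mod_cast hn2
  have hnpos : (0 : ℝ) < n := by linarith
  have hr160 := hr.trans (one_div_twenty_mul_pow_le hn2)
  have hr3 : r * (20 * n ^ 3) ≤ 1 := by rwa [le_div_iff₀ (by positivity)] at hr
  have hint : (0 : E) ∈ interior (Metric.closedBall (0 : E) 1) :=
    Metric.ball_subset_interior_closedBall (Metric.mem_ball_self one_pos)
  have hB : IsBody (Metric.closedBall (0 : E) 1) :=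
    ⟨convex_closedBall _ _, isCompact_closedBall _ _, ⟨0, hint⟩⟩
  have hneg : ∀ x ∈ Metric.closedBall (0 : E) 1, ∃ y ∈ Metric.closedBall (0 : E) 1,
      -x = (1 : ℝ) • y := fun x hx => ⟨-x, by simpa using hx, (one_smul _ _).symm⟩
  -- here `D = 2 n`, so a defect of at most `4 n² D ε' = r² / 18 = t² / 2` has to force distance `t`
  refine distBM_le_of_stable (ε' := r ^ 2 / (144 * n ^ 3)) (t := r / 3) hn2 hn hK hB hint hS
    zero_le_one hneg rfl hε ?_ (by positivity) ?_ hr0.le hr ?_ hdist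
  · rw [lt_div_iff₀ (by positivity)]
    have h1 := mul_le_mul_of_nonneg_left hr3 (sq_nonneg r)
    have h2 := mul_le_mul_of_nonneg_right hadm (by positivity : (0 : ℝ) ≤ 20 * n ^ 3)
    have h3 : 0 < r ^ 2 := by positivity
    nlinarith
  · intro l hl f hf g hg hlf hlg x hx
    have hl1 : ‖l‖ ≤ 1 := by simpa using hl
    have hx1 : ‖x‖ ≤ 1 := by simpa using hx
    have hf1 := norm_le_one_of_mem_polarBody_closedBall hf
    have hg1 := norm_le_one_of_mem_polarBody_closedBall hg
    have hsq : ∀ z : E, ‖z‖ ≤ 1 → ‖z‖ ^ 2 ≤ 1 := fun z hz =>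
      pow_le_one₀ (norm_nonneg z) hz
    have hlf' : l = f := by
      have h1 : ‖l - f‖ ^ 2 ≤ 0 := by
        rw [norm_sub_sq_real, hlf]; linarith [hsq l hl1, hsq f hf1]
      have h2 : ‖l - f‖ = 0 := pow_eq_zero_iff two_ne_zero |>.1 (le_antisymm h1 (sq_nonneg _))
      exact sub_eq_zero.1 (norm_eq_zero.1 h2)
    subst hlf'
    have h1 : 4 * (n : ℝ) ^ 2 * (n * (1 + 1)) * (r ^ 2 / (144 * n ^ 3)) = r ^ 2 / 18 := by
      field_simp; ring
    have h2 : ‖g - l‖ ^ 2 ≤ (r / 3) ^ 2 := by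
      rw [norm_sub_sq_real, real_inner_comm]; linarith [hsq l hl1, hsq g hg1]
    have h3 : ‖g - l‖ ≤ r / 3 := by
      rwa [sq_le_sq₀ (norm_nonneg _) (by positivity)] at h2
    calc ⟪x, g - l⟫ ≤ ‖x‖ * ‖g - l‖ := real_inner_le_norm _ _
      _ ≤ 1 * (r / 3) := by gcongr
      _ = r / 3 := one_mul _
  · have h1 : r ^ 2 / (144 * n ^ 3) * n = r ^ 2 / (144 * n ^ 2) := by field_simp
    have h2 : r ^ 2 / (144 * n ^ 2) ≤ r ^ 2 :=
      div_le_self (sq_nonneg r) (by nlinarith)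
    have h3 : r ^ 2 ≤ 1 / 160 * r := by rw [sq]; gcongr
    have h4 : (1 : ℝ) * r ≤ n ^ 2 * r := by gcongr; nlinarith
    rw [h1]
    linarith

end

end Grunbaum

theorem mainTheorem1 (n : ℕ) (hn : 2 ≤ n)
    (L : Set (EuclideanSpace ℝ (Fin n))) (hL : Grunbaum.IsBody L)
    (hsmooth : Grunbaum.IsSmoothBody L) (h0 : 0 ∈ interior L)
    (hLn : L ⊆ (-(n : ℝ)) • L)
    (δ : ℝ → ℝ) (hδ : δ = Grunbaum.modulusOfConvexity (Grunbaum.polarBody L)) :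
    -- general smooth bodies
    (0 < δ (1 / (80 * (n : ℝ) ^ 6)) / (80 * (n : ℝ) ^ 5) ∧
      ∀ ε : ℝ, 0 ≤ ε → ε ≤ δ (1 / (80 * (n : ℝ) ^ 6)) / (80 * (n : ℝ) ^ 5) →
        (∃ r : ℝ, 0 ≤ r ∧ r < 1 ∧ 4 * (n : ℝ) ^ 2 * ε ≤ r * δ (r / (4 * (n : ℝ) ^ 3))) ∧
        ∀ r : ℝ, 0 ≤ r → r < 1 → 4 * (n : ℝ) ^ 2 * ε ≤ r * δ (r / (4 * (n : ℝ) ^ 3)) →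
          ∀ K S : Set (EuclideanSpace ℝ (Fin n)), Grunbaum.IsBody K →
            Grunbaum.IsRegularSimplex n S → (1 - ε) * (n : ℝ) ≤ Grunbaum.distG K L →
            Grunbaum.distBM K S ≤ 1 + 40 * (n : ℝ) ^ 3 * r) ∧
    -- centrally symmetric smooth bodies
    (Grunbaum.IsCentrallySymmetric L →
      0 < δ (1 / (40 * (n : ℝ) ^ 5)) / (80 * (n : ℝ) ^ 4) ∧
      ∀ ε : ℝ, 0 ≤ ε → ε ≤ δ (1 / (40 * (n : ℝ) ^ 5)) / (80 * (n : ℝ) ^ 4) →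
        (∃ r : ℝ, 0 ≤ r ∧ r < 1 ∧ 4 * (n : ℝ) * ε ≤ r * δ (r / (2 * (n : ℝ) ^ 2))) ∧
        ∀ r : ℝ, 0 ≤ r → r < 1 → 4 * (n : ℝ) * ε ≤ r * δ (r / (2 * (n : ℝ) ^ 2)) →
          ∀ K S : Set (EuclideanSpace ℝ (Fin n)), Grunbaum.IsBody K →
            Grunbaum.IsRegularSimplex n S → (1 - ε) * (n : ℝ) ≤ Grunbaum.distG K L →
            Grunbaum.distBM K S ≤ 1 + 40 * (n : ℝ) ^ 3 * r) ∧
    -- ellipsoids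
    (Grunbaum.IsEllipsoid L →
      ∀ ε : ℝ, 0 ≤ ε → ε ≤ 1 / (128000 * (n : ℝ) ^ 9) →
        (16 * ε) ^ (1 / 3 : ℝ) < 1 ∧
        ∀ K S : Set (EuclideanSpace ℝ (Fin n)), Grunbaum.IsBody K →
          Grunbaum.IsRegularSimplex n S → (1 - ε) * (n : ℝ) ≤ Grunbaum.distG K L →
          Grunbaum.distBM K S ≤ 1 + 40 * (n : ℝ) ^ 3 * (16 * ε) ^ (1 / 3 : ℝ)) := by
  subst hδ
  have hn2' : (2 : ℝ) ≤ n := by exact_mod_cast hn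
  have hnpos : (0 : ℝ) < n := by linarith
  have hfin : Module.finrank ℝ (EuclideanSpace ℝ (Fin n)) = n := finrank_euclideanSpace_fin
  have : Nontrivial (EuclideanSpace ℝ (Fin n)) :=
    Module.nontrivial_of_finrank_pos (R := ℝ) (by omega)
  have hr₀ : (0 : ℝ) < 1 / (20 * (n : ℝ) ^ 3) := by positivity
  have hr₀1 : 1 / (20 * (n : ℝ) ^ 3) < 1 :=
    (Grunbaum.one_div_twenty_mul_pow_le hn).trans_lt (by norm_num)
  have hneg : ∀ x ∈ L, ∃ y ∈ L, -x = (n : ℝ) • y := fun x hx => by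
    obtain ⟨y, hy, rfl⟩ := hLn hx
    exact ⟨y, hy, by simp⟩
  have hδpos : ∀ t : ℝ, 0 < t → t ≤ 1 →
      0 < Grunbaum.modulusOfConvexity (Grunbaum.polarBody L) t := fun t h1 h2 =>
    Grunbaum.modulusOfConvexity_pos hL hsmooth h0 h1 h2
  have hpow : ∀ m : ℕ, (1 : ℝ) ≤ (n : ℝ) ^ m := fun m => one_le_pow₀ (by linarith)
  -- the bounds on `ε` say exactly that `r₀ = 1 / (20 n³)` is admissible
  refine ⟨⟨?_, fun ε hε hε₀ => ?_⟩, fun _ => ⟨?_, fun ε hε hε₀ => ?_⟩, ?_⟩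
  · refine div_pos (hδpos _ (by positivity) ?_) (by positivity)
    rw [div_le_one (by positivity)]
    linarith [hpow 6]
  · have hadm₀ : 4 * (n : ℝ) ^ 2 * ε ≤ 1 / (20 * (n : ℝ) ^ 3) * Grunbaum.modulusOfConvexity
        (Grunbaum.polarBody L) (1 / (20 * (n : ℝ) ^ 3) * (1 / (4 * (n : ℝ) ^ 3))) := by
      have harg : 1 / (20 * (n : ℝ) ^ 3) * (1 / (4 * (n : ℝ) ^ 3)) = 1 / (80 * (n : ℝ) ^ 6) := by
        field_simp; norm_num
      rw [le_div_iff₀ (by positivity)] at hε₀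
      rw [harg, one_div_mul_eq_div, le_div_iff₀ (by positivity)]
      linarith
    refine ⟨⟨_, hr₀.le, hr₀1, by rwa [mul_one_div] at hadm₀⟩,
      fun r hr0 _ hadm K S hK hS hdist => ?_⟩
    rw [← mul_one_div r] at hadm
    refine Grunbaum.distBM_le_of_admissible hn hfin hK hL hsmooth h0 hS hneg
      (by nlinarith) (by positivity) ?_ hε hadm₀ hr0 hadm hdist
    refine one_div_le_one_div_of_le (by positivity) ?_
    have := mul_le_mul_of_nonneg_left hn2' (sq_nonneg (n : ℝ))
    nlinarith
  · refine div_pos (hδpos _ (by positivity) ?_) (by positivity)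
    rw [div_le_one (by positivity)]
    linarith [hpow 5]
  · have hadm₀ : 4 * (n : ℝ) * ε ≤ 1 / (20 * (n : ℝ) ^ 3) * Grunbaum.modulusOfConvexity
        (Grunbaum.polarBody L) (1 / (20 * (n : ℝ) ^ 3) * (1 / (2 * (n : ℝ) ^ 2))) := by
      have harg : 1 / (20 * (n : ℝ) ^ 3) * (1 / (2 * (n : ℝ) ^ 2)) = 1 / (40 * (n : ℝ) ^ 5) := by
        field_simp; norm_num
      rw [le_div_iff₀ (by positivity)] at hε₀
      rw [harg, one_div_mul_eq_div, le_div_iff₀ (by positivity)]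
      linarith
    refine ⟨⟨_, hr₀.le, hr₀1, by rwa [mul_one_div] at hadm₀⟩,
      fun r hr0 _ hadm K S hK hS hdist => ?_⟩
    rw [← mul_one_div r] at hadm
    exact Grunbaum.distBM_le_of_admissible hn hfin hK hL hsmooth h0 hS hneg
      le_rfl (by positivity) le_rfl hε hadm₀ hr0 hadm hdist
  · rintro ⟨T, c, rfl⟩ ε hε hε₀
    set r : ℝ := (16 * ε) ^ (1 / 3 : ℝ) with hr
    have hr0 : 0 ≤ r := by positivity
    have hr3 : r ^ 3 = 16 * ε := by
      rw [hr, ← Real.rpow_natCast, ← Real.rpow_mul (by positivity)]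
      norm_num
    have hrr₀ : r ≤ 1 / (20 * (n : ℝ) ^ 3) := by
      refine le_of_pow_le_pow_left₀ three_ne_zero hr₀.le ?_
      have h1 : (1 / (20 * (n : ℝ) ^ 3)) ^ 3 = 16 * (1 / (128000 * (n : ℝ) ^ 9)) := by
        field_simp; norm_num
      rw [h1, hr3]
      linarith
    refine ⟨hrr₀.trans_lt hr₀1, fun K S hK hS hdist => ?_⟩
    rw [Grunbaum.distG_affine_image_right] at hdist
    rcases hr0.eq_or_lt with h | h
    · rw [← h, mul_zero, add_zero]
      refine Grunbaum.le_one_of_forall_small (by positivity : (0 : ℝ) < 40 * (n : ℝ) ^ 3) hr₀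
        fun r' h1 h2 => Grunbaum.distBM_le_of_closedBall hn hfin hK hS hε h1 h2 ?_ hdist
      rw [← hr3, ← h]
      simp only [ne_eq, OfNat.ofNat_ne_zero, not_false_eq_true, zero_pow]
      positivity
    · exact Grunbaum.distBM_le_of_closedBall hn hfin hK hS hε h hrr₀ hr3.ge hdist
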